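/- Proposition (no P-singular manifold with boundary and constant P-scalar curvature). Let $(\Sigma^n,g)$, $n\ge 1$, be a compact connected smooth Riemannian manifold with nonempty boundary $\partial\Sigma$, and let $f:\Sigma\to\mathbb{R}$ be a smooth non-constant function. Write $\Delta_f u=e^{f}\,\mathrm{div}(e^{-f}\nabla u)$ for the drift Laplacian, $\mathrm{Ric}_f=\mathrm{Ric}+\nabla^2 f$ for the Bakry-Émery Ricci tensor, and $\mathcal{R}_f=R+2\Delta f-|\nabla f|^2$ for the Perelman scalar curvature, where $R$ is the scalar curvature of $g$. The smooth metric measure space $(\Sigma,g,e^{-f}d\mathrm{Vol})$ is called P-singular if the operator $$(\delta\mathcal{R}_f(g))^*u=-(\Delta_f u)\,g+\nabla^2u-u\,\mathrm{Ric}_f,$$ acting on functions $u\in C^\infty(\Sigma)$ with $u|_{\partial\Sigma}=0$ (the formal adjoint, with respect to $e^{-f}d\mathrm{Vol}$, of the linearization of $g\mapsto\mathcal{R}_f(g)$), has a nontrivial kernel. If $\mathcal{R}_f$ is constant on $\Sigma$, then $(\Sigma,g,e^{-f}d\mathrm{Vol})$ is not P-singular; that is, the only $u\in C^\infty(\Sigma)$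 with $u|_{\partial\Sigma}=0$ and $-(\Delta_f u)\,g+\nabla^2u-u\,\mathrm{Ric}_f=0$ is $u=0$. -/

import Mathlib

open Set Manifold ContDiff Bundle

noncomputable section

namespace PSingular

/-! ### Riemannian geometry in local coordinates

`G : ℝⁿ → Matrix` is the coefficient matrix `(g_{ij})` of a metric in a chart of a manifold with
boundary, so all functions live on a relatively open subset of the closed half-space
`range (𝓡∂ n) = {y | 0 ≤ y 0}`; derivatives are taken within that half-space. -/

section Coordinates

variable {n : ℕ} [NeZero n]

/-- The partial derivative `∂_i F`, taken within the closed half-space. -/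
def pd (i : Fin n) (F : EuclideanSpace ℝ (Fin n) → ℝ) (y : EuclideanSpace ℝ (Fin n)) : ℝ :=
  fderivWithin ℝ F (range (𝓡∂ n)) y (EuclideanSpace.single i 1)

variable (G : EuclideanSpace ℝ (Fin n) → Matrix (Fin n) (Fin n) ℝ)

/-- The Christoffel symbols `Γ^k_{ij}` of the Levi-Civita connection. -/
def christoffel (k i j : Fin n) (y : EuclideanSpace ℝ (Fin n)) : ℝ :=
  (1 / 2) * ∑ l, (G y)⁻¹ k l *
    (pd i (fun z => G z j l) y + pd j (fun z => G z i l) y - pd l (fun z => G z i j) y)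

/-- The `i`-th component of the gradient: `(∇F)^i = g^{ij} ∂_j F`. -/
def grad (F : EuclideanSpace ℝ (Fin n) → ℝ) (i : Fin n) (y : EuclideanSpace ℝ (Fin n)) : ℝ :=
  ∑ j, (G y)⁻¹ i j * pd j F y

/-- `|∇F|² = g^{ij} ∂_i F ∂_j F`. -/
def gradNormSq (F : EuclideanSpace ℝ (Fin n) → ℝ) (y : EuclideanSpace ℝ (Fin n)) : ℝ :=
  ∑ i, ∑ j, (G y)⁻¹ i j * pd i F y * pd j F y

/-- The divergence `div X = ∇_i X^i = ∂_i X^i + Γ^i_{ij} X^j` of a vector field. -/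
def divergence (X : Fin n → EuclideanSpace ℝ (Fin n) → ℝ) (y : EuclideanSpace ℝ (Fin n)) : ℝ :=
  ∑ i, (pd i (X i) y + ∑ j, christoffel G i i j y * X j y)

/-- The Hessian `(∇²F)_{ij} = ∂_i ∂_j F - Γ^k_{ij} ∂_k F`. -/
def hessian (F : EuclideanSpace ℝ (Fin n) → ℝ) (i j : Fin n)
    (y : EuclideanSpace ℝ (Fin n)) : ℝ :=
  pd i (pd j F) y - ∑ k, christoffel G k i j y * pd k F y

/-- The Laplacian `ΔF = tr_g ∇²F`. -/
def laplacian (F : EuclideanSpace ℝ (Fin n) → ℝ) (y : EuclideanSpace ℝ (Fin n)) : ℝ :=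
  ∑ i, ∑ j, (G y)⁻¹ i j * hessian G F i j y

/-- The drift Laplacian `Δ_f u = e^f div (e^{-f} ∇u)`. -/
def driftLaplacian (f u : EuclideanSpace ℝ (Fin n) → ℝ) (y : EuclideanSpace ℝ (Fin n)) : ℝ :=
  Real.exp (f y) * divergence G (fun i z => Real.exp (-f z) * grad G u i z) y

/-- The Ricci tensor
`Ric_{ij} = ∂_k Γ^k_{ij} - ∂_j Γ^k_{ik} + Γ^k_{kl} Γ^l_{ij} - Γ^k_{jl} Γ^l_{ik}`
(positive on round spheres). -/
def ricci (i j : Fin n) (y : EuclideanSpace ℝ (Fin n)) : ℝ :=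
  ∑ k, (pd k (christoffel G k i j) y - pd j (christoffel G k i k) y) +
    ∑ k, ∑ l, (christoffel G k k l y * christoffel G l i j y -
      christoffel G k j l y * christoffel G l i k y)

/-- The scalar curvature `R = g^{ij} Ric_{ij}`. -/
def scalarCurvature (y : EuclideanSpace ℝ (Fin n)) : ℝ :=
  ∑ i, ∑ j, (G y)⁻¹ i j * ricci G i j y

/-- The Bakry-Émery Ricci tensor `Ric_f = Ric + ∇²f`. -/
def ricciWeighted (f : EuclideanSpace ℝ (Fin n) → ℝ) (i j : Fin n)
    (y : EuclideanSpace ℝ (Fin n)) : ℝ :=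
  ricci G i j y + hessian G f i j y

/-- The Perelman scalar curvature `𝓡_f = R + 2 Δf - |∇f|²`. -/
def perelmanScalar (f : EuclideanSpace ℝ (Fin n) → ℝ) (y : EuclideanSpace ℝ (Fin n)) : ℝ :=
  scalarCurvature G y + 2 * laplacian G f y - gradNormSq G f y

/-- The operator `(δ𝓡_f(g))^* u = -(Δ_f u) g + ∇²u - u Ric_f`, the formal adjoint, with respect to
the measure `e^{-f} dVol`, of the linearization of `g ↦ 𝓡_f(g)`. -/
def perelmanAdjoint (f u : EuclideanSpace ℝ (Fin n) → ℝ) (i j : Fin n)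
    (y : EuclideanSpace ℝ (Fin n)) : ℝ :=
  -(driftLaplacian G f u y) * G y i j + hessian G u i j y - u y * ricciWeighted G f i j y

end Coordinates

/-! ### Global notions on a smooth Riemannian manifold with boundary -/

section Global

variable {n : ℕ} [NeZero n] {M : Type*} [TopologicalSpace M]
  [ChartedSpace (EuclideanHalfSpace n) M] [IsManifold (𝓡∂ n) ∞ M]

/-- The coordinate expression of a function on `M` in the chart `φ`. -/
def coordFun (φ : OpenPartialHomeomorph M (EuclideanHalfSpace n)) (F : M → ℝ) :
    EuclideanSpace ℝ (Fin n) → ℝ :=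
  fun y => F ((φ.extend (𝓡∂ n)).symm y)

/-- The coordinate vector field `∂/∂x^i` of the chart `φ`, at the point with coordinates `y`. -/
def coordVec (φ : OpenPartialHomeomorph M (EuclideanHalfSpace n)) (i : Fin n)
    (y : EuclideanSpace ℝ (Fin n)) : TangentSpace (𝓡∂ n) ((φ.extend (𝓡∂ n)).symm y) :=
  mfderivWithin 𝓘(ℝ, EuclideanSpace ℝ (Fin n)) (𝓡∂ n) (φ.extend (𝓡∂ n)).symm (range (𝓡∂ n)) y
    (EuclideanSpace.single i 1 : EuclideanSpace ℝ (Fin n))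

variable (g : ContMDiffRiemannianMetric (𝓡∂ n) ∞ (EuclideanSpace ℝ (Fin n))
  (fun p : M => TangentSpace (𝓡∂ n) p))

/-- The coefficients `g_{ij} = g(∂/∂x^i, ∂/∂x^j)` of the metric in the chart `φ`. -/
def coordMetric (φ : OpenPartialHomeomorph M (EuclideanHalfSpace n))
    (y : EuclideanSpace ℝ (Fin n)) : Matrix (Fin n) (Fin n) ℝ :=
  Matrix.of fun i j =>
    g.inner ((φ.extend (𝓡∂ n)).symm y) (coordVec φ i y) (coordVec φ j y)

/-- The Perelman scalar curvature of `(M, g, e^{-f} dVol)` is the constant `c`: it takes this value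
at every point, computed in any smooth chart around the point (it does not depend on the chart). -/
def HasConstantPerelmanScalar (f : M → ℝ) (c : ℝ) : Prop :=
  ∀ φ ∈ IsManifold.maximalAtlas (𝓡∂ n) ∞ M, ∀ p ∈ φ.source,
    perelmanScalar (coordMetric g φ) (coordFun φ f) (φ.extend (𝓡∂ n) p) = c

/-- The kernel of `(δ𝓡_f(g))^*`: the smooth functions `u` on `M` that vanish on the boundary of `M`
and satisfy `-(Δ_f u) g + ∇²u - u Ric_f = 0`, that is, all components of this tensor vanish at every
point in any smooth chart. -/
def perelmanKernel (f : M → ℝ) : Set (M → ℝ) :=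
  {u | ContMDiff (𝓡∂ n) 𝓘(ℝ, ℝ) ∞ u ∧ (∀ p ∈ (𝓡∂ n).boundary M, u p = 0) ∧
    ∀ φ ∈ IsManifold.maximalAtlas (𝓡∂ n) ∞ M, ∀ p ∈ φ.source, ∀ i j : Fin n,
      perelmanAdjoint (coordMetric g φ) (coordFun φ f) (coordFun φ u) i j
        (φ.extend (𝓡∂ n) p) = 0}

/-- `(M, g, e^{-f} dVol)` is Perelman singular: `(δ𝓡_f(g))^*` has a non-trivial kernel. -/
def IsPSingular (f : M → ℝ) : Prop :=
  ∃ u ∈ perelmanKernel g f, u ≠ 0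

end Global

end PSingular

end

/-! Put $h=\Delta_f u$ for $u$ in the kernel. The weighted divergence of
$-hg+\nabla^2u-u\,\mathrm{Ric}_f=0$ decides everything. By the weighted Ricci identity
$\mathrm{div}_f\nabla^2u=\nabla h+\mathrm{Ric}_f(\nabla u)$ and the weighted contracted Bianchi
identity $\mathrm{div}_f\mathrm{Ric}_f=\tfrac12\nabla\mathcal{R}_f$, all that survives is $h\nabla
f=\tfrac12u\nabla\mathcal{R}_f=0$ (`driftLaplacian_mul_derivation_eq_zero`). Hence $h$ vanishes
wherever $\nabla f\ne0$ and, by continuity, together with its first derivatives at every point where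
$f$ is not locally constant.

If $h=0$ everywhere, then $u$ solves $\Delta_fu=0$ with zero boundary values, and the strong maximum
principle applied to $u$ and $-u$ gives $u=0$ (`eq_zero_of_driftLaplacian_eq_zero`). It remains to
treat the open set $U$ where $f$ is locally constant. There $\mathcal{R}_f=R=c$, and the trace of
the equation reads $(n-1)h+cu=0$.

If $n=1$, then $R=0$. A nonempty $U$ forces $c=0$, so $2\Delta f=|\nabla f|^2$ on all of $\Sigma$;
unique continuation makes $f$ constant, which is excluded. So $U$ is empty and $h=0$. If $n\ge2$ and
$c=0$, the trace gives $h=0$ on $U$ as well. If $n\ge2$, $c\ne0$ and $U$ is nonempty, connectedness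
provides a frontier point of $U$. The 1-jets of $h$ and of $(n-1)h+cu$ both vanish there, hence so
does that of $u$. Since $n\ge2$, the trace expresses $h$ through the 1-jet of $u$, so the kernel
equation bounds $\nabla^2u$ by that jet and `eq_zero_of_jet_eq_zero` gives $u=0$.

The tensor identities are proved over an abstract commutative ring with commuting derivations and
then specialised to smooth functions on a chart domain. -/

noncomputable section

namespace PSingular

set_option linter.unusedSectionVars false

/-! ### Riemannian geometry over a commutative ring with commuting derivations -/

section Algebraic

open Matrix

variable {ι A : Type*} [CommRing A] [Algebra ℝ A]

theorem map_derivation_add (d : Derivation ℝ A A) (M N : Matrix ι ι A) :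
    (M + N).map d = M.map d + N.map d := by
  ext i j; simp

theorem map_derivation_sub (d : Derivation ℝ A A) (M N : Matrix ι ι A) :
    (M - N).map d = M.map d - N.map d := by
  ext i j; simp

theorem map_derivation_neg (d : Derivation ℝ A A) (M : Matrix ι ι A) :
    (-M).map d = -M.map d := by
  ext i j; simp

theorem map_derivation_transpose (d : Derivation ℝ A A) (M : Matrix ι ι A) :
    (Mᵀ).map d = (M.map d)ᵀ := rfl

variable [Fintype ι]

theorem map_derivation_mul (d : Derivation ℝ A A) (M N : Matrix ι ι A) :
    (M * N).map d = M.map d * N + M * N.map d := by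
  ext i j
  simp only [map_apply, mul_apply, map_sum, Derivation.leibniz, smul_eq_mul, Matrix.add_apply,
    ← Finset.sum_add_distrib]
  refine Finset.sum_congr rfl fun k _ => by ring

/-- The Christoffel symbols of a metric `G` with inverse `H`, as matrices `(Γ_i)^k_j`. -/
def connectionMatrix (D : ι → Derivation ℝ A A) (G H : Matrix ι ι A) (i : ι) : Matrix ι ι A :=
  Matrix.of fun k j =>
    (1 / 2 : ℝ) • ∑ l, H k l * (D i (G j l) + D j (G i l) - D l (G i j))

/-- The curvature endomorphisms of a family of connection matrices. -/
def curvatureMatrix (D : ι → Derivation ℝ A A) (C : ι → Matrix ι ι A) (i j : ι) :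
    Matrix ι ι A :=
  (C j).map (D i) - (C i).map (D j) + C i * C j - C j * C i

theorem half_smul_add_half_smul (a : A) : (1 / 2 : ℝ) • a + (1 / 2 : ℝ) • a = a := by
  rw [← add_smul]; norm_num

theorem connectionMatrix_symm (D : ι → Derivation ℝ A A) {G : Matrix ι ι A} (H : Matrix ι ι A)
    (hG : Gᵀ = G) (i j k : ι) : connectionMatrix D G H i k j = connectionMatrix D G H j k i := by
  have hs : ∀ a b, G a b = G b a := fun a b => congrFun (congrFun hG b) a
  simp only [connectionMatrix, of_apply]
  congr 1
  refine Finset.sum_congr rfl fun l _ => ?_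
  rw [hs i j]; ring

/-- This is $\nabla g^{-1}=0$. The Koszul formula makes $GC$ half of an expression whose
symmetrisation is $2\,\partial_iG$, so $\partial_iG=GC+C^TG$; differentiating $GH=1$ then gives
$\partial_iH=-H(\partial_iG)H$. -/
theorem map_derivation_inverse [DecidableEq ι] (D : ι → Derivation ℝ A A) {G H : Matrix ι ι A}
    (hG : Gᵀ = G) (hH : G * H = 1) (i : ι) :
    H.map (D i) = -(connectionMatrix D G H i * H) - H * (connectionMatrix D G H i)ᵀ := by
  have hs : ∀ a b, G a b = G b a := fun a b => congrFun (congrFun hG b) a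
  have hH' : H * G = 1 := mul_eq_one_comm.mp hH
  set C := connectionMatrix D G H i with hC
  have hC1 : G * C = (1 / 2 : ℝ) • Matrix.of fun l j =>
      (D i (G j l) + D j (G i l) - D l (G i j)) := by
    have : C = (1 / 2 : ℝ) • (H * Matrix.of fun l j =>
        (D i (G j l) + D j (G i l) - D l (G i j))) := by
      ext a b; simp [hC, connectionMatrix, mul_apply]
    rw [this, Matrix.mul_smul, ← Matrix.mul_assoc, hH, Matrix.one_mul]
  have hdG : G.map (D i) = G * C + Cᵀ * G := by
    have : Cᵀ * G = (G * C)ᵀ := by rw [transpose_mul, hG]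
    rw [this, hC1]
    ext a b
    simp only [map_apply, Matrix.add_apply, Matrix.smul_apply, of_apply, transpose_apply, ← smul_add]
    rw [hs b a]
    rw [show D i (G a b) + D b (G i a) - D a (G i b) + (D i (G a b) + D a (G i b) - D b (G i a))
      = D i (G a b) + D i (G a b) by ring, smul_add, half_smul_add_half_smul]
  have h1 : G.map (D i) * H + G * H.map (D i) = 0 := by
    rw [← map_derivation_mul, hH]
    ext a b
    by_cases h : a = b <;> simp [h, one_apply]
  have h2 : H.map (D i) = -(H * (G.map (D i) * H)) := by
    rw [eq_neg_of_add_eq_zero_left h1, Matrix.mul_neg, neg_neg, ← Matrix.mul_assoc, hH',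
      Matrix.one_mul]
  rw [h2, hdG]
  have e1 : H * ((G * C + Cᵀ * G) * H) = (H * G) * C * H + H * Cᵀ * (G * H) := by noncomm_ring
  rw [e1, hH, hH']; simp; abel

/-- A torsion-free connection `C` compatible with the symmetric contravariant metric `H`. -/
structure IsMetricConnection (D : ι → Derivation ℝ A A) (H : Matrix ι ι A)
    (C : ι → Matrix ι ι A) : Prop where
  comm : ∀ i j a, D i (D j a) = D j (D i a)
  symm : Hᵀ = H
  torsion : ∀ i j k, C i k j = C j k i
  compat : ∀ i, H.map (D i) = -(C i * H) - H * (C i)ᵀ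

theorem isMetricConnection_connectionMatrix [DecidableEq ι] {D : ι → Derivation ℝ A A}
    (hD : ∀ i j a, D i (D j a) = D j (D i a)) {G H : Matrix ι ι A}
    (hG : Gᵀ = G) (hH : G * H = 1) : IsMetricConnection D H (connectionMatrix D G H) where
  comm := hD
  symm := by
    have h1 : Hᵀ * G = 1 := by
      have := congrArg transpose hH
      rwa [transpose_mul, hG, transpose_one] at this
    calc Hᵀ = Hᵀ * (G * H) := by rw [hH, Matrix.mul_one]
      _ = H := by rw [← Matrix.mul_assoc, h1, Matrix.one_mul]
  torsion := connectionMatrix_symm D H hG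
  compat := map_derivation_inverse D hG hH

/-! ### Curvature symmetries and the second Bianchi identity. -/

namespace IsMetricConnection

variable {D : ι → Derivation ℝ A A} {H : Matrix ι ι A} {C : ι → Matrix ι ι A}

theorem map_map_comm (h : IsMetricConnection D H C) (i j : ι) (M : Matrix ι ι A) :
    (M.map (D i)).map (D j) = (M.map (D j)).map (D i) := by
  ext a b; simp [h.comm i j]

theorem map_curvature (i j k : ι) :
    (curvatureMatrix D C i j).map (D k) =
      ((C j).map (D i)).map (D k) - ((C i).map (D j)).map (D k)
        + ((C i).map (D k) * C j + C i * (C j).map (D k))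
        - ((C j).map (D k) * C i + C j * (C i).map (D k)) := by
  rw [curvatureMatrix, map_derivation_sub, map_derivation_add, map_derivation_sub,
    map_derivation_mul, map_derivation_mul]

/-- Only the endomorphism indices are differentiated covariantly: the Christoffel terms acting on
the two form indices would cancel in the cyclic sum. What is left is an identity between
commutators, valid because the derivations commute. -/
theorem bianchi (h : IsMetricConnection D H C) (i j k : ι) :
    ((curvatureMatrix D C i j).map (D k) + C k * curvatureMatrix D C i j
        - curvatureMatrix D C i j * C k)
      + ((curvatureMatrix D C j k).map (D i) + C i * curvatureMatrix D C j k
        - curvatureMatrix D C j k * C i)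
      + ((curvatureMatrix D C k i).map (D j) + C j * curvatureMatrix D C k i
        - curvatureMatrix D C k i * C j) = 0 := by
  simp only [map_curvature]
  rw [h.map_map_comm k i (C j), h.map_map_comm i j (C k), h.map_map_comm j k (C i)]
  simp only [curvatureMatrix]
  noncomm_ring

/-- Since $H$ is parallel, commuting two derivatives of it gives $R_{ij}H+HR_{ij}^T=0$. -/
theorem curvature_antisymm (h : IsMetricConnection D H C) (i j : ι) :
    (curvatureMatrix D C i j * H)ᵀ = -(curvatureMatrix D C i j * H) := by
  have key : ∀ i j, (H.map (D j)).map (D i) =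
      -((C j).map (D i) * H) + C j * C i * H + C j * H * (C i)ᵀ + C i * H * (C j)ᵀ
        + H * (C i)ᵀ * (C j)ᵀ - H * ((C j).map (D i))ᵀ := by
    intro i j
    rw [h.compat j, map_derivation_sub, map_derivation_neg, map_derivation_mul,
      map_derivation_mul, h.compat i, map_derivation_transpose]
    noncomm_ring
  have h1 := h.map_map_comm j i H
  rw [key, key] at h1
  rw [transpose_mul, h.symm]
  simp only [curvatureMatrix, transpose_add, transpose_sub, transpose_mul]
  rw [← sub_eq_zero] at h1 ⊢
  rw [← neg_eq_zero, ← h1]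
  noncomm_ring

theorem curvature_swap (i j : ι) : curvatureMatrix D C i j = -curvatureMatrix D C j i := by
  simp only [curvatureMatrix]; abel

/-- Second Bianchi identity with one index raised. -/
theorem bianchi_raised (h : IsMetricConnection D H C) (i j k : ι) :
    ((curvatureMatrix D C i j * H).map (D k) + C k * (curvatureMatrix D C i j * H)
        + curvatureMatrix D C i j * H * (C k)ᵀ)
      + ((curvatureMatrix D C j k * H).map (D i) + C i * (curvatureMatrix D C j k * H)
        + curvatureMatrix D C j k * H * (C i)ᵀ)
      + ((curvatureMatrix D C k i * H).map (D j) + C j * (curvatureMatrix D C k i * H)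
        + curvatureMatrix D C k i * H * (C j)ᵀ) = 0 := by
  have hb := congrArg (· * H) (h.bianchi i j k)
  simp only [Matrix.zero_mul] at hb
  rw [← hb]
  simp only [map_derivation_mul, h.compat]
  noncomm_ring

end IsMetricConnection

theorem eq_zero_of_eq_neg {a : A} (h : a = -a) : a = 0 := by
  rw [← half_smul_add_half_smul a, ← smul_add]
  nth_rewrite 1 [h]
  simp

/-- The Ricci tensor `Ric_{ij}` of a connection. -/
def ricciTensor (D : ι → Derivation ℝ A A) (C : ι → Matrix ι ι A) (i j : ι) : A :=
  ∑ k, curvatureMatrix D C k j k i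

/-- The mixed Ricci tensor `Ric_l^b`. -/
def mixedRicci (D : ι → Derivation ℝ A A) (H : Matrix ι ι A) (C : ι → Matrix ι ι A)
    (l b : ι) : A :=
  ∑ k, (curvatureMatrix D C k l * H) k b

/-- The divergence `∇_k T_j^k` of a mixed tensor. -/
def mixedDivergence (D : ι → Derivation ℝ A A) (C : ι → Matrix ι ι A) (T : ι → ι → A)
    (j : ι) : A :=
  ∑ k, D k (T j k) + ∑ k, ∑ a, C k k a * T j a - ∑ k, ∑ a, C k a j * T a k

/-- The covariant derivative `∇_j X^k` of a vector field. -/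
def covariantDerivative (D : ι → Derivation ℝ A A) (C : ι → Matrix ι ι A) (X : ι → A)
    (j k : ι) : A :=
  D j (X k) + (C j *ᵥ X) k

/-- The gradient `H^{kl} ∂_l u`. -/
def gradientVector (D : ι → Derivation ℝ A A) (H : Matrix ι ι A) (u : A) : ι → A :=
  H *ᵥ fun l => D l u

/-- The covariant Hessian `∇_j ∂_k u`. -/
def covariantHessian (D : ι → Derivation ℝ A A) (C : ι → Matrix ι ι A) (u : A) (j k : ι) : A :=
  D j (D k u) - ((C j)ᵀ *ᵥ fun l => D l u) k

theorem mixedRicci_eq (D : ι → Derivation ℝ A A) (H : Matrix ι ι A) (C : ι → Matrix ι ι A)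
    (l b : ι) : mixedRicci D H C l b = ∑ m, ricciTensor D C m l * H m b := by
  simp only [mixedRicci, ricciTensor, mul_apply, Finset.sum_mul]
  exact Finset.sum_comm

theorem mixedDivergence_smul (D : ι → Derivation ℝ A A) (C : ι → Matrix ι ι A) (a : A)
    (T : ι → ι → A) (j : ι) : mixedDivergence D C (fun j k => a * T j k) j =
      ∑ k, D k a * T j k + a * mixedDivergence D C T j := by
  simp only [mixedDivergence, Derivation.leibniz, smul_eq_mul, mul_sub, mul_add, Finset.mul_sum,
    Finset.sum_add_distrib]
  have e1 : ∀ k l, C k k l * (a * T j l) = a * (C k k l * T j l) := fun _ _ => by ring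
  have e2 : ∀ k l, C k l j * (a * T l k) = a * (C k l j * T l k) := fun _ _ => by ring
  simp only [e1, e2, mul_comm (T j _) (D _ a)]
  abel

theorem mixedDivergence_add (D : ι → Derivation ℝ A A) (C : ι → Matrix ι ι A)
    (S T : ι → ι → A) (j : ι) : mixedDivergence D C (fun j k => S j k + T j k) j =
      mixedDivergence D C S j + mixedDivergence D C T j := by
  simp only [mixedDivergence, map_add, mul_add, Finset.sum_add_distrib]
  abel

theorem mixedDivergence_one [DecidableEq ι] (D : ι → Derivation ℝ A A) (C : ι → Matrix ι ι A)
    (j : ι) : mixedDivergence D C (fun j k => if j = k then 1 else 0) j = 0 := by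
  have : ∀ k, D k (if j = k then (1 : A) else 0) = 0 := fun k => by split_ifs <;> simp
  simp [mixedDivergence, this]

/-! ### Contracted identities: Ricci commutation and the divergence of the Ricci tensor. -/

namespace IsMetricConnection

variable {D : ι → Derivation ℝ A A} {H : Matrix ι ι A} {C : ι → Matrix ι ι A}

theorem covariantDerivative_gradient (h : IsMetricConnection D H C) (u : A) (j k : ι) :
    covariantDerivative D C (gradientVector D H u) j k =
      ∑ l, H k l * covariantHessian D C u j l := by
  have h1 : D j (gradientVector D H u k) =
      (H.map (D j) *ᵥ fun l => D l u) k + (H *ᵥ fun l => D j (D l u)) k := by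
    simp only [gradientVector, mulVec, dotProduct, map_sum, Derivation.leibniz, smul_eq_mul,
      Finset.sum_add_distrib, map_apply]
    rw [add_comm]
    congr 1
    exact Finset.sum_congr rfl fun _ _ => mul_comm _ _
  have h2 : ∑ l, H k l * covariantHessian D C u j l =
      (H *ᵥ fun l => D j (D l u)) k - ((H * (C j)ᵀ) *ᵥ fun l => D l u) k := by
    rw [← mulVec_mulVec]
    simp only [covariantHessian, mul_sub, Finset.sum_sub_distrib]
    rfl
  rw [covariantDerivative, h1, h2, h.compat, gradientVector, mulVec_mulVec, sub_mulVec,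
    neg_mulVec]
  simp only [Pi.sub_apply, Pi.neg_apply]
  abel

/-- Leibniz rule for $\langle\nabla f,\nabla u\rangle$: the connection terms on the two factors
cancel because the metric is parallel and symmetric. -/
theorem derivation_inner_gradient (h : IsMetricConnection D H C) (f u : A) (j : ι) :
    D j (∑ k, D k f * gradientVector D H u k) =
      ∑ k, D k f * covariantDerivative D C (gradientVector D H u) j k +
        ∑ k, D k u * covariantDerivative D C (gradientVector D H f) j k := by
  have hs : ∀ a b, H a b = H b a := fun a b => congrFun (congrFun h.symm b) a
  have h1 : ∑ k, D k u * covariantDerivative D C (gradientVector D H f) j k =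
      ∑ k, covariantHessian D C f j k * gradientVector D H u k := by
    simp only [h.covariantDerivative_gradient]
    simp only [gradientVector, mulVec, dotProduct, Finset.mul_sum]
    rw [Finset.sum_comm]
    refine Finset.sum_congr rfl fun a _ => Finset.sum_congr rfl fun b _ => ?_
    rw [hs b a]; ring
  have h2 : ∑ k, ((C j)ᵀ *ᵥ fun l => D l f) k * gradientVector D H u k =
      ∑ k, D k f * (C j *ᵥ gradientVector D H u) k := by
    simp only [mulVec, dotProduct, Finset.mul_sum, Finset.sum_mul, transpose_apply]
    rw [Finset.sum_comm]
    refine Finset.sum_congr rfl fun a _ => Finset.sum_congr rfl fun b _ => ?_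
    ring
  rw [h1]
  simp only [covariantHessian, covariantDerivative, sub_mul, mul_add, Finset.sum_add_distrib,
    Finset.sum_sub_distrib, h2, map_sum, Derivation.leibniz, smul_eq_mul,
    mul_comm (gradientVector D H u _)]
  abel

/-- The contracted Ricci identity: interchanging $\nabla_k$ and $\nabla_j$ on $X^k$ costs one
curvature term. Torsion-freeness turns the correction for the lower index into the connection term
of $\nabla_j$. -/
theorem mixedDivergence_covariantDerivative (h : IsMetricConnection D H C) (X : ι → A) (j : ι) :
    mixedDivergence D C (covariantDerivative D C X) j =
      D j (∑ k, covariantDerivative D C X k k) + ∑ m, ricciTensor D C m j * X m := by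
  have e1 : ∑ k, ∑ a, C k a j * covariantDerivative D C X a k =
      ∑ k, (C j *ᵥ covariantDerivative D C X k) k := by
    rw [Finset.sum_comm]
    simp only [mulVec, dotProduct]
    refine Finset.sum_congr rfl fun a _ => Finset.sum_congr rfl fun b _ => ?_
    rw [h.torsion b j a]
  have e2 : ∑ m, ricciTensor D C m j * X m = ∑ k, (curvatureMatrix D C k j *ᵥ X) k := by
    simp only [ricciTensor, mulVec, dotProduct, Finset.sum_mul]
    exact Finset.sum_comm
  have hd : ∀ i l k, D i (covariantDerivative D C X l k) = D i (D l (X k)) +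
      ((C l).map (D i) *ᵥ X) k + (C l *ᵥ fun b => D i (X b)) k := by
    intro i l k
    simp only [covariantDerivative, mulVec, dotProduct, map_add, map_sum, Derivation.leibniz,
      smul_eq_mul, Finset.sum_add_distrib, map_apply, mul_comm (X _)]
    abel
  have hc : ∀ i l, C i *ᵥ covariantDerivative D C X l =
      (C i *ᵥ fun b => D l (X b)) + (C i * C l) *ᵥ X := by
    intro i l
    rw [← mulVec_mulVec, ← mulVec_add]
    rfl
  rw [mixedDivergence, e1, e2, map_sum, ← Finset.sum_add_distrib, ← Finset.sum_sub_distrib,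
    ← Finset.sum_add_distrib]
  refine Finset.sum_congr rfl fun k _ => ?_
  change _ + (C k *ᵥ covariantDerivative D C X j) k - _ = _
  rw [hc, hc, hd, hd, curvatureMatrix, sub_mulVec, add_mulVec, sub_mulVec, h.comm k j]
  simp only [Pi.add_apply, Pi.sub_apply]
  abel

/-- The contracted second Bianchi identity: of the three cyclic terms, one contracts to $\nabla_lR$
and the other two each to $-\nabla_k\mathrm{Ric}_l{}^k$. -/
theorem two_mul_mixedDivergence_mixedRicci (h : IsMetricConnection D H C) (l : ι) :
    2 * mixedDivergence D C (mixedRicci D H C) l = D l (∑ j, mixedRicci D H C j j) := by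
  set P : ι → ι → Matrix ι ι A := fun i j => curvatureMatrix D C i j * H with hP
  have hP1 : ∀ i j a b, P i j a b = -P j i a b := fun i j a b => by
    simp only [hP]
    rw [curvature_swap, Matrix.neg_mul]; rfl
  have hP2 : ∀ i j a b, P i j a b = -P i j b a := fun i j a b =>
    congrFun (congrFun (h.curvature_antisymm i j) b) a
  have hQ : ∀ i b, mixedRicci D H C i b = ∑ k, P k i k b := fun _ _ => rfl
  have hb : ∑ k, ∑ j, ((D l (P k j k j) + ∑ a, C l k a * P k j a j + ∑ a, P k j k a * C l j a)
      + (D k (P j l k j) + ∑ a, C k k a * P j l a j + ∑ a, P j l k a * C k j a)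
      + (D j (P l k k j) + ∑ a, C j k a * P l k a j + ∑ a, P l k k a * C j j a)) = 0 :=
    Finset.sum_eq_zero fun k _ => Finset.sum_eq_zero fun j _ =>
      congrFun (congrFun (h.bianchi_raised k j l) k) j
  simp only [Finset.sum_add_distrib] at hb
  have t1 : ∑ k, ∑ j, D l (P k j k j) = D l (∑ j, mixedRicci D H C j j) := by
    rw [Finset.sum_comm]; simp only [hQ, map_sum]
  have t2 : ∑ k, ∑ j, ∑ a, C l k a * P k j a j = ∑ k, ∑ a, C l k a * mixedRicci D H C k a := by
    refine Finset.sum_congr rfl fun k _ => ?_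
    rw [Finset.sum_comm]
    simp only [hQ, Finset.mul_sum]
    refine Finset.sum_congr rfl fun a _ => Finset.sum_congr rfl fun j _ => ?_
    rw [hP1 k j, hP2 j k a j, neg_neg]
  have t3 : ∑ k, ∑ j, ∑ a, P k j k a * C l j a = ∑ k, ∑ a, C l k a * mixedRicci D H C k a := by
    rw [Finset.sum_comm]
    refine Finset.sum_congr rfl fun k _ => ?_
    rw [Finset.sum_comm]
    simp only [hQ, Finset.mul_sum]
    refine Finset.sum_congr rfl fun a _ => Finset.sum_congr rfl fun j _ => ?_
    ring
  have t4 : ∑ k, ∑ j, D k (P j l k j) = -∑ k, D k (mixedRicci D H C l k) := by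
    simp only [hQ, map_sum, ← Finset.sum_neg_distrib]
    refine Finset.sum_congr rfl fun a _ => Finset.sum_congr rfl fun j _ => ?_
    rw [hP2, map_neg]
  have t5 : ∑ k, ∑ j, ∑ a, C k k a * P j l a j = -∑ k, ∑ a, C k k a * mixedRicci D H C l a := by
    simp only [hQ, Finset.mul_sum, ← Finset.sum_neg_distrib]
    refine Finset.sum_congr rfl fun k _ => ?_
    rw [Finset.sum_comm]
    refine Finset.sum_congr rfl fun a _ => Finset.sum_congr rfl fun j _ => ?_
    rw [hP2]; ring
  -- The curvature is antisymmetric in $k,a$ while the Christoffel symbol is symmetric in them. The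
  -- sum `t8` vanishes for the same reason.
  have t6 : ∑ k, ∑ j, ∑ a, P j l k a * C k j a = 0 := by
    rw [Finset.sum_comm]
    refine Finset.sum_eq_zero fun j _ => eq_zero_of_eq_neg ?_
    rw [← Finset.sum_neg_distrib, Finset.sum_comm]
    refine Finset.sum_congr rfl fun a _ => ?_
    rw [← Finset.sum_neg_distrib]
    refine Finset.sum_congr rfl fun k _ => ?_
    rw [hP2, h.torsion k a j]; ring
  have t7 : ∑ k, ∑ j, D j (P l k k j) = -∑ k, D k (mixedRicci D H C l k) := by
    rw [Finset.sum_comm]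
    simp only [hQ, map_sum, ← Finset.sum_neg_distrib]
    refine Finset.sum_congr rfl fun a _ => Finset.sum_congr rfl fun j _ => ?_
    rw [hP1, map_neg]
  have t8 : ∑ k, ∑ j, ∑ a, C j k a * P l k a j = 0 := by
    refine Finset.sum_eq_zero fun k _ => eq_zero_of_eq_neg ?_
    rw [← Finset.sum_neg_distrib, Finset.sum_comm]
    refine Finset.sum_congr rfl fun a _ => ?_
    rw [← Finset.sum_neg_distrib]
    refine Finset.sum_congr rfl fun j _ => ?_
    rw [hP2, h.torsion j a k]; ring
  have t9 : ∑ k, ∑ j, ∑ a, P l k k a * C j j a = -∑ k, ∑ a, C k k a * mixedRicci D H C l a := by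
    rw [Finset.sum_comm]
    simp only [hQ, Finset.mul_sum, ← Finset.sum_neg_distrib]
    refine Finset.sum_congr rfl fun k _ => ?_
    rw [Finset.sum_comm]
    refine Finset.sum_congr rfl fun a _ => Finset.sum_congr rfl fun j _ => ?_
    rw [hP1]; ring
  rw [t1, t2, t3, t4, t5, t6, t7, t8, t9] at hb
  have e : ∑ k, ∑ a, C k a l * mixedRicci D H C a k = ∑ k, ∑ a, C l k a * mixedRicci D H C k a := by
    rw [Finset.sum_comm]
    refine Finset.sum_congr rfl fun a _ => Finset.sum_congr rfl fun b _ => ?_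
    rw [h.torsion b l a]
  rw [mixedDivergence, e]
  linear_combination -hb

/-- If `-h g + ∇²u - u Ric_f = 0` with `h = Δ_f u`, and `R + 2 Δf - |∇f|²` is constant, then
`h ∇f = 0`. -/
theorem driftLaplacian_mul_derivation_eq_zero [DecidableEq ι] (h : IsMetricConnection D H C)
    {f u w c : A} (hc : ∀ i, D i c = 0)
    (hw : w = ∑ k, covariantDerivative D C (gradientVector D H u) k k -
      ∑ k, D k f * gradientVector D H u k)
    (hE : ∀ j k, -w * (if j = k then 1 else 0) +
      covariantDerivative D C (gradientVector D H u) j k -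
      u * (mixedRicci D H C j k + covariantDerivative D C (gradientVector D H f) j k) = 0)
    (hR : ∑ j, mixedRicci D H C j j +
      2 * ∑ k, covariantDerivative D C (gradientVector D H f) k k -
      ∑ k, D k f * gradientVector D H f k = c) (j : ι) : w * D j f = 0 := by
  set T := covariantDerivative D C (gradientVector D H u) with hT
  set F := covariantDerivative D C (gradientVector D H f) with hF
  set Q := mixedRicci D H C with hQ
  have ricQ : ∀ v : A, ∑ m, ricciTensor D C m j * gradientVector D H v m =
      ∑ k, D k v * Q j k := by
    intro v
    simp only [hQ, mixedRicci_eq, gradientVector, mulVec, dotProduct, Finset.mul_sum]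
    rw [Finset.sum_comm]
    refine Finset.sum_congr rfl fun a _ => Finset.sum_congr rfl fun b _ => by ring
  have hdiv : mixedDivergence D C (fun j k => (-w * (if j = k then 1 else 0) + T j k) +
      (-u) * (Q j k + F j k)) j = 0 := by
    have : (fun j k => (-w * (if j = k then 1 else 0) + T j k) + (-u) * (Q j k + F j k)) =
        fun _ _ => 0 := by
      funext j k
      linear_combination hE j k
    rw [this]; simp [mixedDivergence]
  have hT2 := h.mixedDivergence_covariantDerivative (gradientVector D H u) j
  have hF2 := h.mixedDivergence_covariantDerivative (gradientVector D H f) j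
  have hQ2 := h.two_mul_mixedDivergence_mixedRicci j
  rw [ricQ] at hT2 hF2
  rw [mixedDivergence_add, mixedDivergence_add, mixedDivergence_smul, mixedDivergence_smul,
    mixedDivergence_add, mixedDivergence_one] at hdiv
  rw [← hT] at hT2
  rw [← hF] at hF2
  rw [← hQ] at hQ2
  have hdw := congrArg (D j) hw
  rw [map_sub, h.derivation_inner_gradient f u j, ← hT, ← hF] at hdw
  have hdR := congrArg (D j) hR
  rw [map_sub, map_add, h.derivation_inner_gradient f f j, ← hF, hc, Derivation.leibniz] at hdR
  have h2 : D j (2 : A) = 0 := by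
    have := (D j).map_natCast 2
    simpa using this
  rw [h2] at hdR
  -- `hdiv` is an unweighted divergence; contracting the equation with $\nabla f$ supplies the drift
  -- term of $\mathrm{div}_f$, and it is the source of $h\nabla f$.
  have hEf : ∑ k, D k f * (-w * (if j = k then 1 else 0) + T j k - u * (Q j k + F j k)) = 0 :=
    Finset.sum_eq_zero fun k _ => by rw [hE, mul_zero]
  simp only [mul_add, mul_sub, Finset.sum_add_distrib, Finset.sum_sub_distrib, map_neg, neg_mul,
    mul_neg, Finset.sum_neg_distrib, mul_ite, mul_one, mul_zero, Finset.sum_ite_eq,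
    Finset.mem_univ, if_true, smul_eq_mul, mul_left_comm (D _ f) u, ← Finset.mul_sum] at hdiv hdR hEf
  -- The derivatives of $h$ and the Ricci and Hessian terms paired with $\nabla u$ and $\nabla f$
  -- cancel; the terms with factor $u$ add up to $u\,\partial_j\mathcal{R}_f=0$. The factor 2 comes
  -- from the contracted Bianchi identity.
  have goal2 : 2 * (w * D j f) = 0 := by
    linear_combination 2 * hdiv - 2 * hEf - 2 * hT2 + 2 * hdw + u * hQ2 + 2 * u * hF2 + u * hdR
  refine eq_zero_of_eq_neg ?_
  linear_combination goal2

end IsMetricConnection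

end Algebraic

/-! ### The ring of smooth functions on a relatively open subset of the half-space -/

section SmoothFunctions

open Filter Topology

variable {n : ℕ} [NeZero n]

/-- `S` is a relatively open subset of the half-space. -/
structure IsRelOpen (S : Set (EuclideanSpace ℝ (Fin n))) : Prop where
  subset : S ⊆ range (𝓡∂ n)
  mem_nhdsWithin : ∀ y ∈ S, S ∈ 𝓝[range (𝓡∂ n)] y

theorem pd_congr_of_eventuallyEq {F F' : EuclideanSpace ℝ (Fin n) → ℝ}
    {y : EuclideanSpace ℝ (Fin n)} (hy : y ∈ range (𝓡∂ n)) (h : F =ᶠ[𝓝[range (𝓡∂ n)] y] F')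
    (i : Fin n) : pd i F y = pd i F' y := by
  rw [pd, pd, h.fderivWithin_eq (h.self_of_nhdsWithin hy)]

variable {S : Set (EuclideanSpace ℝ (Fin n))}

theorem IsRelOpen.eventuallyEq (hS : IsRelOpen S) {F F' : EuclideanSpace ℝ (Fin n) → ℝ}
    (h : EqOn F F' S) {y : EuclideanSpace ℝ (Fin n)} (hy : y ∈ S) :
    F =ᶠ[𝓝[range (𝓡∂ n)] y] F' :=
  Filter.mem_of_superset (hS.mem_nhdsWithin y hy) fun _ hz => h hz

theorem IsRelOpen.pd_congr (hS : IsRelOpen S) {F F' : EuclideanSpace ℝ (Fin n) → ℝ}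
    (h : EqOn F F' S) (i : Fin n) : EqOn (pd i F) (pd i F') S := fun _ hy =>
  pd_congr_of_eventuallyEq (hS.subset hy) (hS.eventuallyEq h hy) i

theorem IsRelOpen.contDiffWithinAt (hS : IsRelOpen S) {F : EuclideanSpace ℝ (Fin n) → ℝ}
    (hF : ContDiffOn ℝ ∞ F S) {y : EuclideanSpace ℝ (Fin n)} (hy : y ∈ S) :
    ContDiffWithinAt ℝ ∞ F (range (𝓡∂ n)) y :=
  (hF y hy).mono_of_mem_nhdsWithin (hS.mem_nhdsWithin y hy)

theorem IsRelOpen.differentiableWithinAt (hS : IsRelOpen S)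
    {F : EuclideanSpace ℝ (Fin n) → ℝ}
    (hF : ContDiffOn ℝ ∞ F S) {y : EuclideanSpace ℝ (Fin n)} (hy : y ∈ S) :
    DifferentiableWithinAt ℝ F (range (𝓡∂ n)) y :=
  (hS.contDiffWithinAt hF hy).differentiableWithinAt (by simp)

theorem IsRelOpen.contDiffOn_pd (hS : IsRelOpen S) {F : EuclideanSpace ℝ (Fin n) → ℝ}
    (hF : ContDiffOn ℝ ∞ F S) (i : Fin n) : ContDiffOn ℝ ∞ (pd i F) S := fun y hy =>
  (((hS.contDiffWithinAt hF hy).fderivWithin_right (𝓡∂ n).uniqueDiffOn (by simp)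
    (hS.subset hy)).clm_apply contDiffWithinAt_const).mono hS.subset

theorem two_le_smooth : (2 : WithTop ℕ∞) ≤ ∞ :=
  WithTop.coe_le_coe.mpr (le_top : (2 : ℕ∞) ≤ ⊤)

theorem pd_mul {F F' : EuclideanSpace ℝ (Fin n) → ℝ} {y : EuclideanSpace ℝ (Fin n)}
    (hy : y ∈ range (𝓡∂ n)) (hF : DifferentiableWithinAt ℝ F (range (𝓡∂ n)) y)
    (hF' : DifferentiableWithinAt ℝ F' (range (𝓡∂ n)) y) (i : Fin n) :
    pd i (fun z => F z * F' z) y = F y * pd i F' y + F' y * pd i F y := by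
  rw [pd, fderivWithin_fun_mul ((𝓡∂ n).uniqueDiffOn y hy) hF hF']
  simp [pd]

theorem pd_add {F F' : EuclideanSpace ℝ (Fin n) → ℝ} {y : EuclideanSpace ℝ (Fin n)}
    (hy : y ∈ range (𝓡∂ n)) (hF : DifferentiableWithinAt ℝ F (range (𝓡∂ n)) y)
    (hF' : DifferentiableWithinAt ℝ F' (range (𝓡∂ n)) y) (i : Fin n) :
    pd i (fun z => F z + F' z) y = pd i F y + pd i F' y := by
  rw [pd, fderivWithin_fun_add ((𝓡∂ n).uniqueDiffOn y hy) hF hF']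
  simp [pd]

theorem pd_const_mul (c : ℝ) {F : EuclideanSpace ℝ (Fin n) → ℝ} {y : EuclideanSpace ℝ (Fin n)}
    (hy : y ∈ range (𝓡∂ n)) (hF : DifferentiableWithinAt ℝ F (range (𝓡∂ n)) y) (i : Fin n) :
    pd i (fun z => c * F z) y = c * pd i F y := by
  rw [pd, fderivWithin_const_mul ((𝓡∂ n).uniqueDiffOn y hy) hF]
  simp [pd]

theorem pd_const (c : ℝ) (y : EuclideanSpace ℝ (Fin n)) (i : Fin n) :
    pd i (fun _ => c) y = 0 := by
  rw [pd, fderivWithin_fun_const]; simp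

theorem pd_exp_neg {F : EuclideanSpace ℝ (Fin n) → ℝ} {y : EuclideanSpace ℝ (Fin n)}
    (hy : y ∈ range (𝓡∂ n)) (hF : DifferentiableWithinAt ℝ F (range (𝓡∂ n)) y) (i : Fin n) :
    pd i (fun z => Real.exp (-F z)) y = -(Real.exp (-F y) * pd i F y) := by
  rw [pd, fderivWithin_exp hF.fun_neg ((𝓡∂ n).uniqueDiffOn y hy), fderivWithin_fun_neg
    ((𝓡∂ n).uniqueDiffOn y hy)]
  simp [pd]

/-- Symmetry of second derivatives persists at boundary points because the half-space lies in the
closure of its interior. -/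
theorem IsRelOpen.pd_comm (hS : IsRelOpen S) {F : EuclideanSpace ℝ (Fin n) → ℝ}
    (hF : ContDiffOn ℝ ∞ F S) (i j : Fin n) {y : EuclideanSpace ℝ (Fin n)} (hy : y ∈ S) :
    pd i (pd j F) y = pd j (pd i F) y := by
  have hF' := hS.contDiffWithinAt hF hy
  have hy' := hS.subset hy
  have hsymm : IsSymmSndFDerivWithinAt ℝ F (range (𝓡∂ n)) y :=
    hF'.isSymmSndFDerivWithinAt (by simpa using two_le_smooth) (𝓡∂ n).uniqueDiffOn
      ((𝓡∂ n).range_subset_closure_interior hy') hy'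
  have hd : DifferentiableWithinAt ℝ (fderivWithin ℝ F (range (𝓡∂ n))) (range (𝓡∂ n)) y :=
    (hF'.fderivWithin_right (m := 1) (𝓡∂ n).uniqueDiffOn
      (by simpa [one_add_one_eq_two] using two_le_smooth) hy').differentiableWithinAt (by simp)
  have key : ∀ k l, pd k (pd l F) y =
      fderivWithin ℝ (fderivWithin ℝ F (range (𝓡∂ n))) (range (𝓡∂ n)) y
        (EuclideanSpace.single k 1) (EuclideanSpace.single l 1) := by
    intro k l
    have := fderivWithin_clm_apply (u := fun _ => (EuclideanSpace.single l (1 : ℝ)))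
      ((𝓡∂ n).uniqueDiffOn y hy') hd (differentiableWithinAt_const _)
    unfold pd
    rw [this]
    simp
  rw [key, key]
  exact hsymm _ _

/-- The smooth functions on `S`. -/
def smoothFunctions (S : Set (EuclideanSpace ℝ (Fin n))) : Subalgebra ℝ (S → ℝ) where
  -- Elements live on the subtype, so agreement on `S` is equality. The zero extension only makes
  -- `ContDiffOn` applicable; its values off `S` are irrelevant.
  carrier := {a | ContDiffOn ℝ ∞ (Function.extend Subtype.val a 0) S}
  mul_mem' {a b} ha hb := (ha.mul hb).congr fun y hy => by
    lift y to S using hy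
    simp
  add_mem' {a b} ha hb := (ha.add hb).congr fun y hy => by
    lift y to S using hy
    simp
  algebraMap_mem' c := (contDiffOn_const (c := c)).congr fun y hy => by
    lift y to S using hy
    simp

/-- A smooth function, extended by zero. -/
def extendZero (a : smoothFunctions S) : EuclideanSpace ℝ (Fin n) → ℝ :=
  Function.extend Subtype.val a.1 0

@[simp] theorem extendZero_coe (a : smoothFunctions S) (y : S) : extendZero a y = a.1 y :=
  Subtype.val_injective.extend_apply _ _ _

theorem contDiffOn_extendZero (a : smoothFunctions S) : ContDiffOn ℝ ∞ (extendZero a) S := a.2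

/-- The restriction to `S` of a function smooth on `S`. -/
def toSmooth (F : EuclideanSpace ℝ (Fin n) → ℝ) (hF : ContDiffOn ℝ ∞ F S) :
    smoothFunctions S :=
  ⟨fun y => F y, hF.congr fun y hy => by
    lift y to S using hy
    simp⟩

/-- `a` is the restriction of `F`. -/
def Represents (F : EuclideanSpace ℝ (Fin n) → ℝ) (a : smoothFunctions S) : Prop :=
  ∀ y : S, F y = a.1 y

theorem represents_toSmooth (F : EuclideanSpace ℝ (Fin n) → ℝ) (hF : ContDiffOn ℝ ∞ F S) :
    Represents F (toSmooth F hF) := fun _ => rfl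

theorem represents_extendZero (a : smoothFunctions S) : Represents (extendZero a) a :=
  extendZero_coe a

theorem Represents.contDiffOn {F : EuclideanSpace ℝ (Fin n) → ℝ} {a : smoothFunctions S}
    (h : Represents F a) : ContDiffOn ℝ ∞ F S :=
  (contDiffOn_extendZero a).congr fun y hy => by
    lift y to S using hy
    rw [h, extendZero_coe]

theorem Represents.eqOn {F F' : EuclideanSpace ℝ (Fin n) → ℝ} {a : smoothFunctions S}
    (h : Represents F a) (h' : Represents F' a) : EqOn F F' S := fun y hy =>
  (h ⟨y, hy⟩).trans (h' ⟨y, hy⟩).symm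

/-- Turns pointwise identities on `S` into ring identities; `Represents.eqOn` goes back. -/
theorem Represents.unique {F : EuclideanSpace ℝ (Fin n) → ℝ} {a b : smoothFunctions S}
    (h : Represents F a) (h' : Represents F b) : a = b :=
  Subtype.ext (funext fun y => (h y).symm.trans (h' y))

theorem Represents.add {F F' : EuclideanSpace ℝ (Fin n) → ℝ} {a b : smoothFunctions S}
    (h : Represents F a) (h' : Represents F' b) : Represents (fun y => F y + F' y) (a + b) :=
  fun y => congrArg₂ (· + ·) (h y) (h' y)

theorem Represents.sub {F F' : EuclideanSpace ℝ (Fin n) → ℝ} {a b : smoothFunctions S}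
    (h : Represents F a) (h' : Represents F' b) : Represents (fun y => F y - F' y) (a - b) :=
  fun y => congrArg₂ (· - ·) (h y) (h' y)

theorem Represents.mul {F F' : EuclideanSpace ℝ (Fin n) → ℝ} {a b : smoothFunctions S}
    (h : Represents F a) (h' : Represents F' b) : Represents (fun y => F y * F' y) (a * b) :=
  fun y => congrArg₂ (· * ·) (h y) (h' y)

theorem Represents.neg {F : EuclideanSpace ℝ (Fin n) → ℝ} {a : smoothFunctions S}
    (h : Represents F a) : Represents (fun y => -F y) (-a) :=
  fun y => congrArg (- ·) (h y)

theorem Represents.const_mul {F : EuclideanSpace ℝ (Fin n) → ℝ} {a : smoothFunctions S}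
    (h : Represents F a) (c : ℝ) : Represents (fun y => c * F y) (c • a) :=
  fun y => congrArg (c * ·) (h y)

theorem Represents.sum {ι : Type*} {s : Finset ι} {F : ι → EuclideanSpace ℝ (Fin n) → ℝ}
    {a : ι → smoothFunctions S} (h : ∀ i, Represents (F i) (a i)) :
    Represents (fun y => ∑ i ∈ s, F i y) (∑ i ∈ s, a i) := by
  intro y
  rw [AddSubmonoidClass.coe_finsetSum, Finset.sum_apply]
  exact Finset.sum_congr rfl fun i _ => h i y

/-- The partial derivatives, as derivations of the ring of smooth functions. -/
def partialDerivation (hS : IsRelOpen S) (i : Fin n) :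
    Derivation ℝ (smoothFunctions S) (smoothFunctions S) where
  toFun a := toSmooth (pd i (extendZero a)) (hS.contDiffOn_pd (contDiffOn_extendZero a) i)
  map_add' a b := by
    ext y
    change pd i (extendZero (a + b)) y = pd i (extendZero a) y + pd i (extendZero b) y
    rw [← pd_add (hS.subset y.2) (hS.differentiableWithinAt (contDiffOn_extendZero a) y.2)
      (hS.differentiableWithinAt (contDiffOn_extendZero b) y.2)]
    exact hS.pd_congr ((represents_extendZero _).eqOn
      ((represents_extendZero a).add (represents_extendZero b))) i y.2
  map_smul' c a := by
    ext y
    change pd i (extendZero (c • a)) y = c * pd i (extendZero a) y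
    rw [← pd_const_mul c (hS.subset y.2)
      (hS.differentiableWithinAt (contDiffOn_extendZero a) y.2)]
    exact hS.pd_congr ((represents_extendZero _).eqOn
      ((represents_extendZero a).const_mul c)) i y.2
  map_one_eq_zero' := by
    ext y
    change pd i (extendZero 1) y = 0
    rw [← pd_const 1 y.1 i]
    exact hS.pd_congr ((represents_extendZero _).eqOn fun _ => rfl) i y.2
  leibniz' a b := by
    ext y
    change pd i (extendZero (a * b)) y =
      a.1 y * pd i (extendZero b) y + b.1 y * pd i (extendZero a) y
    rw [← extendZero_coe a, ← extendZero_coe b, ← pd_mul (hS.subset y.2)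
      (hS.differentiableWithinAt (contDiffOn_extendZero a) y.2)
      (hS.differentiableWithinAt (contDiffOn_extendZero b) y.2)]
    exact hS.pd_congr ((represents_extendZero _).eqOn
      ((represents_extendZero a).mul (represents_extendZero b))) i y.2

theorem Represents.pd {F : EuclideanSpace ℝ (Fin n) → ℝ} {a : smoothFunctions S}
    (h : Represents F a) (hS : IsRelOpen S) (i : Fin n) :
    Represents (pd i F) (partialDerivation hS i a) := fun y =>
  hS.pd_congr (h.eqOn (represents_extendZero a)) i y.2

theorem partialDerivation_comm (hS : IsRelOpen S) (i j : Fin n) (a : smoothFunctions S) :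
    partialDerivation hS i (partialDerivation hS j a) =
      partialDerivation hS j (partialDerivation hS i a) := by
  have h := represents_extendZero a
  refine Subtype.ext (funext fun y => ?_)
  rw [← ((h.pd hS j).pd hS i) y, ← ((h.pd hS i).pd hS j) y]
  exact hS.pd_comm (contDiffOn_extendZero a) i j y.2

/-- Needed for the determinant of the metric, so that the matrix inverse over the ring of smooth
functions is a genuine inverse. -/
theorem isUnit_of_forall_ne_zero (a : smoothFunctions S) (h : ∀ y, a.1 y ≠ 0) : IsUnit a := by
  have h' : ∀ y ∈ S, extendZero a y ≠ 0 := fun y hy => by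
    rw [extendZero_coe a ⟨y, hy⟩]; exact h _
  refine IsUnit.of_mul_eq_one
    (toSmooth (fun y => (extendZero a y)⁻¹) ((contDiffOn_extendZero a).inv h')) ?_
  ext y
  change a.1 y * (extendZero a y)⁻¹ = 1
  rw [extendZero_coe, mul_inv_cancel₀ (h y)]

end SmoothFunctions

/-! ### Smooth metrics on relatively open subsets of the half-space -/

section SmoothMetric

open Matrix

variable {n : ℕ} [NeZero n] {S : Set (EuclideanSpace ℝ (Fin n))}
  {G : EuclideanSpace ℝ (Fin n) → Matrix (Fin n) (Fin n) ℝ}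

/-- `G` is a smooth Riemannian metric on the relatively open set `S`. -/
structure IsSmoothMetric (S : Set (EuclideanSpace ℝ (Fin n)))
    (G : EuclideanSpace ℝ (Fin n) → Matrix (Fin n) (Fin n) ℝ) : Prop where
  isRelOpen : IsRelOpen S
  contDiffOn : ∀ i j, ContDiffOn ℝ ∞ (fun y => G y i j) S
  posDef : ∀ y ∈ S, (G y).PosDef

namespace IsSmoothMetric

theorem symm (hG : IsSmoothMetric S G) {y : EuclideanSpace ℝ (Fin n)} (hy : y ∈ S) :
    (G y)ᵀ = G y := by
  simpa [Matrix.IsHermitian, conjTranspose_eq_transpose_of_trivial] using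
    (hG.posDef y hy).isHermitian

/-- The metric as a matrix of smooth functions. -/
def toMatrix (hG : IsSmoothMetric S G) : Matrix (Fin n) (Fin n) (smoothFunctions S) :=
  Matrix.of fun i j => toSmooth (fun y => G y i j) (hG.contDiffOn i j)

theorem represents_toMatrix (hG : IsSmoothMetric S G) (i j : Fin n) :
    Represents (fun y => G y i j) (hG.toMatrix i j) := fun _ => rfl

theorem toMatrix_transpose (hG : IsSmoothMetric S G) : hG.toMatrixᵀ = hG.toMatrix := by
  ext i j y
  exact congrFun (congrFun (hG.symm y.2) i) j

/-- Evaluation of smooth functions at a point. -/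
def evalHom (y : S) : smoothFunctions S →+* ℝ :=
  (Pi.evalRingHom (fun _ : S => ℝ) y).comp (smoothFunctions S).val.toRingHom

theorem map_evalHom (hG : IsSmoothMetric S G) (y : S) : hG.toMatrix.map (evalHom y) = G y := by
  ext i j; rfl

theorem toMatrix_mul_inv (hG : IsSmoothMetric S G) : hG.toMatrix * hG.toMatrix⁻¹ = 1 := by
  refine mul_nonsing_inv _ (isUnit_of_forall_ne_zero _ fun y => ?_)
  change evalHom y _ ≠ 0
  rw [RingHom.map_det, RingHom.mapMatrix_apply, hG.map_evalHom]
  exact (hG.posDef y y.2).det_pos.ne'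

theorem represents_inv (hG : IsSmoothMetric S G) (i j : Fin n) :
    Represents (fun y => (G y)⁻¹ i j) (hG.toMatrix⁻¹ i j) := by
  intro y
  have h := congrArg (fun M => M.map (evalHom y)) hG.toMatrix_mul_inv
  simp only [Matrix.map_mul, hG.map_evalHom] at h
  rw [Matrix.map_one _ (map_zero _) (map_one _)] at h
  change (G y)⁻¹ i j = _
  rw [inv_eq_right_inv h]
  rfl

/-- The partial derivatives on the domain of a metric. -/
abbrev partialDeriv (hG : IsSmoothMetric S G) (i : Fin n) :
    Derivation ℝ (smoothFunctions S) (smoothFunctions S) :=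
  partialDerivation hG.isRelOpen i

/-- The Levi-Civita connection matrices. -/
abbrev connection (hG : IsSmoothMetric S G) :
    Fin n → Matrix (Fin n) (Fin n) (smoothFunctions S) :=
  connectionMatrix hG.partialDeriv hG.toMatrix hG.toMatrix⁻¹

theorem isMetricConnection (hG : IsSmoothMetric S G) :
    IsMetricConnection hG.partialDeriv hG.toMatrix⁻¹ hG.connection :=
  isMetricConnection_connectionMatrix (partialDerivation_comm hG.isRelOpen)
    hG.toMatrix_transpose hG.toMatrix_mul_inv

theorem represents_christoffel (hG : IsSmoothMetric S G) (k i j : Fin n) :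
    Represents (christoffel G k i j) (hG.connection i k j) :=
  Represents.const_mul (Represents.sum fun l => (hG.represents_inv k l).mul
    ((((hG.represents_toMatrix j l).pd hG.isRelOpen i).add
      ((hG.represents_toMatrix i l).pd hG.isRelOpen j)).sub
      ((hG.represents_toMatrix i j).pd hG.isRelOpen l))) _

variable {F : EuclideanSpace ℝ (Fin n) → ℝ} {a : smoothFunctions S}

theorem represents_grad (hG : IsSmoothMetric S G) (h : Represents F a) (i : Fin n) :
    Represents (grad G F i) (gradientVector hG.partialDeriv hG.toMatrix⁻¹ a i) :=
  Represents.sum fun j => (hG.represents_inv i j).mul (h.pd hG.isRelOpen j)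

theorem represents_gradNormSq (hG : IsSmoothMetric S G) (h : Represents F a) :
    Represents (gradNormSq G F)
      (∑ k, hG.partialDeriv k a * gradientVector hG.partialDeriv hG.toMatrix⁻¹ a k) := by
  have h1 : Represents (gradNormSq G F)
      (∑ k, ∑ j, hG.toMatrix⁻¹ k j * hG.partialDeriv k a * hG.partialDeriv j a) :=
    Represents.sum fun i => Represents.sum fun j => ((hG.represents_inv i j).mul
      (h.pd hG.isRelOpen i)).mul (h.pd hG.isRelOpen j)
  convert h1 using 2
  simp only [gradientVector, mulVec, dotProduct, Finset.mul_sum]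
  exact Finset.sum_congr rfl fun _ _ => by ring

theorem represents_divergence (hG : IsSmoothMetric S G)
    {X : Fin n → EuclideanSpace ℝ (Fin n) → ℝ} {x : Fin n → smoothFunctions S}
    (h : ∀ i, Represents (X i) (x i)) :
    Represents (divergence G X) (∑ i, covariantDerivative hG.partialDeriv hG.connection x i i) :=
  Represents.sum fun i => ((h i).pd hG.isRelOpen i).add
    (Represents.sum fun j => (hG.represents_christoffel i i j).mul (h j))

theorem represents_hessian (hG : IsSmoothMetric S G) (h : Represents F a) (i j : Fin n) :
    Represents (hessian G F i j) (covariantHessian hG.partialDeriv hG.connection a i j) :=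
  (((h.pd hG.isRelOpen j).pd hG.isRelOpen i)).sub
    (Represents.sum fun k => (hG.represents_christoffel k i j).mul (h.pd hG.isRelOpen k))

theorem represents_laplacian (hG : IsSmoothMetric S G) (h : Represents F a) :
    Represents (laplacian G F) (∑ k, covariantDerivative hG.partialDeriv hG.connection
      (gradientVector hG.partialDeriv hG.toMatrix⁻¹ a) k k) := by
  simp only [hG.isMetricConnection.covariantDerivative_gradient]
  exact Represents.sum fun i => Represents.sum fun j =>
    (hG.represents_inv i j).mul (hG.represents_hessian h i j)

theorem represents_ricci (hG : IsSmoothMetric S G) (i j : Fin n) :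
    Represents (ricci G i j) (ricciTensor hG.partialDeriv hG.connection i j) := by
  have h := hG.represents_christoffel
  have h1 : Represents (ricci G i j)
      (∑ k, (hG.partialDeriv k (hG.connection i k j) - hG.partialDeriv j (hG.connection i k k)) +
        ∑ k, ∑ l, (hG.connection k k l * hG.connection i l j -
          hG.connection j k l * hG.connection i l k)) :=
    (Represents.sum fun k => ((h k i j).pd hG.isRelOpen k).sub
      ((h k i k).pd hG.isRelOpen j)).add (Represents.sum fun k => Represents.sum fun l =>
        ((h k k l).mul (h l i j)).sub ((h k j l).mul (h l i k)))
  convert h1 using 1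
  rw [ricciTensor, ← Finset.sum_add_distrib]
  refine Finset.sum_congr rfl fun k _ => ?_
  simp only [curvatureMatrix, Matrix.add_apply, Matrix.sub_apply, Matrix.mul_apply, map_apply,
    Finset.sum_sub_distrib]
  simp only [hG.isMetricConnection.torsion i j _, hG.isMetricConnection.torsion i k _]
  abel

theorem represents_scalarCurvature (hG : IsSmoothMetric S G) :
    Represents (scalarCurvature G)
      (∑ j, mixedRicci hG.partialDeriv hG.toMatrix⁻¹ hG.connection j j) := by
  have h1 : Represents (scalarCurvature G)
      (∑ i, ∑ j, hG.toMatrix⁻¹ i j * ricciTensor hG.partialDeriv hG.connection i j) :=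
    Represents.sum fun i => Represents.sum fun j =>
      (hG.represents_inv i j).mul (hG.represents_ricci i j)
  convert h1 using 1
  simp only [mixedRicci_eq]
  rw [Finset.sum_comm]
  exact Finset.sum_congr rfl fun _ _ => Finset.sum_congr rfl fun _ _ => mul_comm _ _

variable {f u : EuclideanSpace ℝ (Fin n) → ℝ} {φ υ : smoothFunctions S}

/-- The product rule brings down $-\partial f$ from $e^{-f}$ and the two exponentials cancel,
leaving $\Delta u-\langle\nabla f,\nabla u\rangle$. -/
theorem represents_driftLaplacian (hG : IsSmoothMetric S G) (hf : Represents f φ)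
    (hu : Represents u υ) : Represents (driftLaplacian G f u)
      (∑ k, covariantDerivative hG.partialDeriv hG.connection
        (gradientVector hG.partialDeriv hG.toMatrix⁻¹ υ) k k -
        ∑ k, hG.partialDeriv k φ * gradientVector hG.partialDeriv hG.toMatrix⁻¹ υ k) := by
  have hS := hG.isRelOpen
  set e := toSmooth (fun y => Real.exp (-f y)) hf.contDiffOn.neg.exp
  have he : Represents (fun y => Real.exp (-f y)) e := represents_toSmooth _ _
  set e' := toSmooth (fun y => Real.exp (f y)) hf.contDiffOn.exp
  have he' : Represents (fun y => Real.exp (f y)) e' := represents_toSmooth _ _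
  have hee : e' * e = 1 := by
    ext y
    change Real.exp (f y) * Real.exp (-f y) = 1
    rw [← Real.exp_add]; simp
  have hde : ∀ i, hG.partialDeriv i e = -(e * hG.partialDeriv i φ) := by
    intro i
    refine (he.pd hS i).unique fun y => ?_
    rw [pd_exp_neg (hS.subset y.2) (hS.differentiableWithinAt hf.contDiffOn y.2)]
    exact ((he.mul (hf.pd hS i)).neg) y
  have h1 : Represents (driftLaplacian G f u) _ :=
    he'.mul (hG.represents_divergence fun i => he.mul (hG.represents_grad hu i))
  convert h1 using 1
  set X := gradientVector hG.partialDeriv hG.toMatrix⁻¹ υ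
  have h2 : ∀ k, covariantDerivative hG.partialDeriv hG.connection (fun i => e * X i) k k =
      e * (covariantDerivative hG.partialDeriv hG.connection X k k - hG.partialDeriv k φ * X k) := by
    intro k
    have h3 : (hG.connection k *ᵥ fun i => e * X i) k = e * (hG.connection k *ᵥ X) k :=
      congrFun (mulVec_smul (hG.connection k) e X) k
    rw [covariantDerivative, h3, Derivation.leibniz, hde, smul_eq_mul, smul_eq_mul,
      covariantDerivative]
    ring
  simp only [h2]
  rw [← Finset.mul_sum, ← mul_assoc, hee, one_mul, Finset.sum_sub_distrib]

theorem contDiffOn_driftLaplacian (hG : IsSmoothMetric S G) (hf : ContDiffOn ℝ ∞ f S)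
    (hu : ContDiffOn ℝ ∞ u S) : ContDiffOn ℝ ∞ (driftLaplacian G f u) S :=
  (hG.represents_driftLaplacian (represents_toSmooth f hf)
    (represents_toSmooth u hu)).contDiffOn

theorem driftLaplacian_eq (hG : IsSmoothMetric S G) (hf : ContDiffOn ℝ ∞ f S)
    (hu : ContDiffOn ℝ ∞ u S) {y : EuclideanSpace ℝ (Fin n)} (hy : y ∈ S) :
    driftLaplacian G f u y = laplacian G u y - ∑ k, pd k f y * grad G u k y := by
  have hf' := represents_toSmooth f hf
  have hu' := represents_toSmooth u hu
  exact (hG.represents_driftLaplacian hf' hu').eqOn ((hG.represents_laplacian hu').sub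
    (Represents.sum fun k => (hf'.pd hG.isRelOpen k).mul (hG.represents_grad hu' k))) hy

/-- Where the Perelman scalar curvature is constant, the kernel equation forces
`Δ_f u ∇f = 0`. -/
theorem driftLaplacian_mul_pd_eq_zero (hG : IsSmoothMetric S G) (hf : ContDiffOn ℝ ∞ f S)
    (hu : ContDiffOn ℝ ∞ u S) {c : ℝ} (hR : ∀ y ∈ S, perelmanScalar G f y = c)
    (hE : ∀ y ∈ S, ∀ i j, perelmanAdjoint G f u i j y = 0)
    {y : EuclideanSpace ℝ (Fin n)} (hy : y ∈ S) (j : Fin n) :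
    driftLaplacian G f u y * pd j f y = 0 := by
  have hf' := represents_toSmooth f hf
  have hu' := represents_toSmooth u hu
  set φ := toSmooth f hf
  set υ := toSmooth u hu
  have hC := hG.isMetricConnection
  have hw := hG.represents_driftLaplacian hf' hu'
  set w := ∑ k, covariantDerivative hG.partialDeriv hG.connection
        (gradientVector hG.partialDeriv hG.toMatrix⁻¹ υ) k k -
        ∑ k, hG.partialDeriv k φ * gradientVector hG.partialDeriv hG.toMatrix⁻¹ υ k with hwdef
  have hsymm : ∀ (v : smoothFunctions S) (i j : Fin n),
      covariantHessian hG.partialDeriv hG.connection v i j =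
        covariantHessian hG.partialDeriv hG.connection v j i := by
    intro v i j
    rw [covariantHessian, covariantHessian, hC.comm]
    congr 1
    simp only [mulVec, dotProduct, transpose_apply]
    exact Finset.sum_congr rfl fun k _ => by rw [hC.torsion]
  have hEq : ∀ i j, -w * hG.toMatrix i j + covariantHessian hG.partialDeriv hG.connection υ i j -
      υ * (ricciTensor hG.partialDeriv hG.connection i j +
        covariantHessian hG.partialDeriv hG.connection φ i j) = 0 := by
    intro i j
    have h1 : Represents (perelmanAdjoint G f u i j) _ :=
      ((hw.neg.mul (hG.represents_toMatrix i j)).add (hG.represents_hessian hu' i j)).sub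
      (hu'.mul ((hG.represents_ricci i j).add (hG.represents_hessian hf' i j)))
    exact h1.unique fun y => hE y y.2 i j
  have key := hC.driftLaplacian_mul_derivation_eq_zero (f := φ) (u := υ) (w := w)
    (c := algebraMap ℝ _ c) (fun i => Derivation.map_algebraMap _ _) hwdef ?_ ?_ j
  · exact (((hw.mul (hf'.pd hG.isRelOpen j)) ⟨y, hy⟩).trans
      (congrArg (fun a => a.1 ⟨y, hy⟩) key) : _)
  · intro j k
    -- One index of the kernel equation is raised; symmetry of the Hessians then matches the index
    -- order of the mixed form.
    have h0 : ∑ l, hG.toMatrix⁻¹ k l * (-w * hG.toMatrix l j +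
        covariantHessian hG.partialDeriv hG.connection υ l j -
        υ * (ricciTensor hG.partialDeriv hG.connection l j +
        covariantHessian hG.partialDeriv hG.connection φ l j)) = 0 :=
      Finset.sum_eq_zero fun l _ => by rw [hEq, mul_zero]
    have h1 : ∑ l, hG.toMatrix⁻¹ k l * hG.toMatrix l j = if j = k then 1 else 0 := by
      rw [← Matrix.mul_apply, mul_eq_one_comm.mp hG.toMatrix_mul_inv, Matrix.one_apply]
      simp only [eq_comm]
    have hs : ∀ a b, hG.toMatrix⁻¹ a b = hG.toMatrix⁻¹ b a :=
      fun a b => congrFun (congrFun hC.symm b) a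
    rw [hC.covariantDerivative_gradient, hC.covariantDerivative_gradient, mixedRicci_eq, ← h1,
      ← h0]
    simp only [Finset.mul_sum, ← Finset.sum_add_distrib, ← Finset.sum_sub_distrib]
    refine Finset.sum_congr rfl fun l _ => ?_
    rw [hs k l, hsymm υ j l, hsymm φ j l]
    ring
  · have h1 : Represents (perelmanScalar G f) _ :=
      ((hG.represents_scalarCurvature.add ((hG.represents_laplacian hf').const_mul 2))).sub
        (hG.represents_gradNormSq hf')
    have h2 := h1.unique (b := algebraMap ℝ _ c) fun y => hR y y.2
    rw [← h2, two_mul, two_smul]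

/-- The trace of the kernel equation. -/
theorem mul_driftLaplacian_eq (hG : IsSmoothMetric S G)
    {y : EuclideanSpace ℝ (Fin n)} (hy : y ∈ S)
    (hE : ∀ i j, perelmanAdjoint G f u i j y = 0) :
    n * driftLaplacian G f u y =
      laplacian G u y - u y * (scalarCurvature G y + laplacian G f y) := by
  have h0 : ∑ i, ∑ j, (G y)⁻¹ i j * perelmanAdjoint G f u i j y = 0 :=
    Finset.sum_eq_zero fun i _ => Finset.sum_eq_zero fun j _ => by rw [hE, mul_zero]
  have h1 : ∑ i, ∑ j, (G y)⁻¹ i j * G y i j = n := by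
    have : ∀ i, ∑ j, (G y)⁻¹ i j * G y i j = ((G y)⁻¹ * G y) i i := fun i => by
      rw [Matrix.mul_apply]
      refine Finset.sum_congr rfl fun j _ => ?_
      rw [← congrFun (congrFun (hG.symm hy) i) j]; rfl
    simp only [this, nonsing_inv_mul _ (isUnit_iff_ne_zero.mpr (hG.posDef y hy).det_pos.ne')]
    simp
  have h2 : ∑ i, ∑ j, (G y)⁻¹ i j * perelmanAdjoint G f u i j y =
      -(driftLaplacian G f u y) * ∑ i, ∑ j, (G y)⁻¹ i j * G y i j + laplacian G u y -
        u y * (scalarCurvature G y + laplacian G f y) := by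
    simp only [laplacian, scalarCurvature, Finset.mul_sum, ← Finset.sum_add_distrib,
      ← Finset.sum_sub_distrib]
    refine Finset.sum_congr rfl fun i _ => Finset.sum_congr rfl fun j _ => ?_
    rw [perelmanAdjoint, ricciWeighted]
    ring
  rw [h2, h1] at h0
  linarith

end IsSmoothMetric

end SmoothMetric

/-! ### Metrics and functions in the preferred charts of a manifold with boundary -/

section Charts

open Filter Topology

theorem posDef_gram {n : ℕ} {V : Type*} [AddCommGroup V] [Module ℝ V] (B : V →ₗ[ℝ] V →ₗ[ℝ] ℝ)
    (hB : ∀ v w, B v w = B w v) (hpos : ∀ v, v ≠ 0 → 0 < B v v)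
    (L : EuclideanSpace ℝ (Fin n) →ₗ[ℝ] V) (hL : Function.Injective L) :
    (Matrix.of fun i j => B (L (EuclideanSpace.single i 1)) (L (EuclideanSpace.single j 1)) :
      Matrix (Fin n) (Fin n) ℝ).PosDef := by
  refine Matrix.PosDef.of_dotProduct_mulVec_pos ?_ fun x hx => ?_
  · ext i j
    exact hB _ _
  · set v : EuclideanSpace ℝ (Fin n) := WithLp.toLp 2 x with hv
    have hv0 : L v ≠ 0 := by
      intro h0
      have : v = 0 := hL (h0.trans (map_zero L).symm)
      exact hx (by simpa [hv] using this)
    have hvs : v = ∑ i, x i • (EuclideanSpace.single i (1 : ℝ) : EuclideanSpace ℝ (Fin n)) := by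
      ext k; simp [hv, Pi.single_apply]
    have h1 : star x ⬝ᵥ (Matrix.of fun i j => B (L (EuclideanSpace.single i 1))
        (L (EuclideanSpace.single j 1)) : Matrix (Fin n) (Fin n) ℝ).mulVec x = B (L v) (L v) := by
      rw [hvs]
      simp only [map_sum, map_smul, LinearMap.sum_apply, LinearMap.smul_apply, star_trivial,
        smul_eq_mul, dotProduct, Matrix.mulVec, Finset.mul_sum, Matrix.of_apply]
      refine Finset.sum_congr rfl fun i _ => Finset.sum_congr rfl fun j _ => ?_
      rw [hB (L (EuclideanSpace.single j 1))]; ring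
    rw [h1]
    exact hpos _ hv0

variable {n : ℕ} [NeZero n] {M : Type*} [TopologicalSpace M]
  [ChartedSpace (EuclideanHalfSpace n) M] [IsManifold (𝓡∂ n) ∞ M]

theorem isRelOpen_extChartAt_target (p : M) : IsRelOpen (extChartAt (𝓡∂ n) p).target where
  subset := extChartAt_target_subset_range p
  mem_nhdsWithin _ hy := extChartAt_target_mem_nhdsWithin_of_mem hy

theorem contMDiffOn_coordVec (p : M) (i : Fin n) :
    ContMDiffOn 𝓘(ℝ, EuclideanSpace ℝ (Fin n)) (𝓡∂ n).tangent ∞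
      (fun y => TotalSpace.mk' (EuclideanSpace ℝ (Fin n)) (E := fun p : M => TangentSpace (𝓡∂ n) p)
        ((extChartAt (𝓡∂ n) p).symm y)
        (coordVec (chartAt (EuclideanHalfSpace n) p) i y)) (extChartAt (𝓡∂ n) p).target := by
  have hS := isRelOpen_extChartAt_target (n := n) p
  have h1 := (contMDiffOn_extChartAt_symm (I := 𝓡∂ n) (n := ∞) p).contMDiffOn_tangentMapWithin
    (m := ∞) (by simp) (uniqueDiffOn_extChartAt_target p).uniqueMDiffOn
  have h2 : ContMDiff 𝓘(ℝ, EuclideanSpace ℝ (Fin n)) 𝓘(ℝ, EuclideanSpace ℝ (Fin n)).tangent ∞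
      (fun y : EuclideanSpace ℝ (Fin n) => TotalSpace.mk' (EuclideanSpace ℝ (Fin n))
        (E := fun p : EuclideanSpace ℝ (Fin n) =>
          TangentSpace 𝓘(ℝ, EuclideanSpace ℝ (Fin n)) p) y
        (EuclideanSpace.single i (1 : ℝ) : EuclideanSpace ℝ (Fin n))) :=
    contMDiff_vectorSpace_iff_contDiff.mpr contDiff_const
  refine (h1.comp h2.contMDiffOn fun y hy => hy).congr fun y hy => ?_
  -- The tangent map is taken within the chart target, `coordVec` within the whole half-space; the
  -- two sets agree near `y`.
  have h3 : (extChartAt (𝓡∂ n) p).target =ᶠ[𝓝 y] range (𝓡∂ n) :=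
    nhdsWithin_eq_iff_eventuallyEq.mp (nhdsWithin_extChartAt_target_eq_of_mem hy)
  simp only [Function.comp, tangentMapWithin, mfderivWithin_congr_set h3]
  rfl

variable (g : ContMDiffRiemannianMetric (𝓡∂ n) ∞ (EuclideanSpace ℝ (Fin n))
  (fun p : M => TangentSpace (𝓡∂ n) p))

theorem contDiffOn_coordMetric (p : M) (i j : Fin n) :
    ContDiffOn ℝ ∞ (fun y => coordMetric g (chartAt (EuclideanHalfSpace n) p) y i j)
      (extChartAt (𝓡∂ n) p).target := by
  rw [← contMDiffOn_iff_contDiffOn]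
  have h1 := contMDiffOn_coordVec (n := n) p i
  have h2 := contMDiffOn_coordVec (n := n) p j
  intro y hy
  have : ContMDiffWithinAt 𝓘(ℝ, EuclideanSpace ℝ (Fin n)) ((𝓡∂ n).prod 𝓘(ℝ)) ∞
      (fun y => TotalSpace.mk' ℝ (E := Bundle.Trivial M ℝ) ((extChartAt (𝓡∂ n) p).symm y)
        (g.inner ((extChartAt (𝓡∂ n) p).symm y)
          (coordVec (chartAt (EuclideanHalfSpace n) p) i y)
          (coordVec (chartAt (EuclideanHalfSpace n) p) j y)))
      (extChartAt (𝓡∂ n) p).target y := by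
    apply ContMDiffWithinAt.clm_bundle_apply₂ (F₁ := EuclideanSpace ℝ (Fin n))
      (F₂ := EuclideanSpace ℝ (Fin n))
    · exact ContMDiffAt.comp_contMDiffWithinAt y g.contMDiff.contMDiffAt
        (contMDiffOn_extChartAt_symm p y hy)
    · exact h1 y hy
    · exact h2 y hy
  simp only [contMDiffWithinAt_totalSpace] at this
  exact this.2

theorem isSmoothMetric_coordMetric (p : M) : IsSmoothMetric (extChartAt (𝓡∂ n) p).target
    (coordMetric g (chartAt (EuclideanHalfSpace n) p)) where
  isRelOpen := isRelOpen_extChartAt_target p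
  contDiffOn := contDiffOn_coordMetric g p
  posDef y hy := posDef_gram (LinearMap.mk₂ ℝ
      (fun v w => g.inner ((extChartAt (𝓡∂ n) p).symm y) v w)
      (fun a b c => DFunLike.congr_fun (map_add (g.inner _) a b) c)
      (fun r a b => DFunLike.congr_fun (map_smul (g.inner _) r a) b)
      (fun a b c => map_add (g.inner _ a) b c)
      (fun r a b => map_smul (g.inner _ a) r b)) (g.symm _) (g.pos _)
    (mfderivWithin 𝓘(ℝ, EuclideanSpace ℝ (Fin n)) (𝓡∂ n) (extChartAt (𝓡∂ n) p).symm
      (range (𝓡∂ n)) y).toLinearMap (isInvertible_mfderivWithin_extChartAt_symm hy).injective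

theorem contDiffOn_coordFun {f : M → ℝ} (hf : ContMDiff (𝓡∂ n) 𝓘(ℝ, ℝ) ∞ f) (p : M) :
    ContDiffOn ℝ ∞ (coordFun (chartAt (EuclideanHalfSpace n) p) f)
      (extChartAt (𝓡∂ n) p).target := by
  rw [← contMDiffOn_iff_contDiffOn]
  exact hf.comp_contMDiffOn (contMDiffOn_extChartAt_symm p)

end Charts

/-! ### Local analysis in the half-space -/

section LocalAnalysis

open Filter Topology Asymptotics

variable {n : ℕ} [NeZero n] {S : Set (EuclideanSpace ℝ (Fin n))}

theorem fderivWithin_apply_eq_sum_pd (F : EuclideanSpace ℝ (Fin n) → ℝ)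
    (y v : EuclideanSpace ℝ (Fin n)) :
    fderivWithin ℝ F (range (𝓡∂ n)) y v = ∑ i, v i * pd i F y := by
  have hv : v = ∑ i, v i • (EuclideanSpace.single i (1 : ℝ) : EuclideanSpace ℝ (Fin n)) := by
    ext k; simp [Pi.single_apply]
  conv_lhs => rw [hv]
  simp only [map_sum, map_smul, smul_eq_mul, pd]

theorem IsRelOpen.exists_ball (hS : IsRelOpen S) {y : EuclideanSpace ℝ (Fin n)} (hy : y ∈ S)
    {P : EuclideanSpace ℝ (Fin n) → Prop} (hP : ∀ᶠ z in 𝓝[range (𝓡∂ n)] y, P z) :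
    ∃ r > 0, ∀ z ∈ Metric.ball y r ∩ range (𝓡∂ n), z ∈ S ∧ P z := by
  obtain ⟨r, hr, h⟩ := Metric.mem_nhdsWithin_iff.mp (hP.and (hS.mem_nhdsWithin y hy))
  exact ⟨r, hr, fun z hz => ⟨(h hz).2, (h hz).1⟩⟩

/-- Otherwise the differential vanishes on a ball intersected with the half-space, which is convex,
so `f` is constant there. -/
theorem IsRelOpen.frequently_pd_ne_zero (hS : IsRelOpen S)
    {f : EuclideanSpace ℝ (Fin n) → ℝ} (hf : ContDiffOn ℝ ∞ f S)
    {y : EuclideanSpace ℝ (Fin n)} (hy : y ∈ S)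
    (hc : ¬ ∀ᶠ z in 𝓝[range (𝓡∂ n)] y, f z = f y) :
    ∃ᶠ z in 𝓝[range (𝓡∂ n)] y, z ∈ S ∧ ∃ j, pd j f z ≠ 0 := by
  intro h
  refine hc ?_
  obtain ⟨r, hr, hb⟩ := hS.exists_ball hy h
  have hconv : Convex ℝ (Metric.ball y r ∩ range (𝓡∂ n)) :=
    (convex_ball y r).inter (𝓡∂ n).convex_range
  have hnhds : ∀ z ∈ Metric.ball y r ∩ range (𝓡∂ n), Metric.ball y r ∈ 𝓝 z :=
    fun z hz => Metric.isOpen_ball.mem_nhds hz.1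
  have hyb : y ∈ Metric.ball y r ∩ range (𝓡∂ n) := ⟨Metric.mem_ball_self hr, hS.subset hy⟩
  have hzero : ∀ z ∈ Metric.ball y r ∩ range (𝓡∂ n),
      fderivWithin ℝ f (Metric.ball y r ∩ range (𝓡∂ n)) z = 0 := by
    intro z hz
    rw [inter_comm, fderivWithin_inter (hnhds z hz)]
    ext v
    rw [fderivWithin_apply_eq_sum_pd]
    refine Finset.sum_eq_zero fun i _ => ?_
    have := (hb z hz).2
    push Not at this
    rw [this (hb z hz).1 i, mul_zero]
  have hd : DifferentiableOn ℝ f (Metric.ball y r ∩ range (𝓡∂ n)) := fun z hz =>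
    ((hf z (hb z hz).1).differentiableWithinAt (by simp)).mono fun w hw => (hb w hw).1
  refine mem_of_superset (inter_mem (mem_nhdsWithin_of_mem_nhds (Metric.ball_mem_nhds y hr))
    self_mem_nhdsWithin) fun z hz => ?_
  exact hconv.is_const_of_fderivWithin_eq_zero hd hzero hz hyb

/-- Unique continuation from a point, for functions whose second derivatives are controlled by
the 1-jet. -/
theorem IsRelOpen.eventually_eq_zero (hS : IsRelOpen S)
    {F : EuclideanSpace ℝ (Fin n) → ℝ} (hF : ContDiffOn ℝ ∞ F S)
    {y : EuclideanSpace ℝ (Fin n)} (hy : y ∈ S)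
    (hO : ∀ i j, pd i (pd j F) =O[𝓝[range (𝓡∂ n)] y] fun z => |F z| + ∑ k, |pd k F z|)
    (h0 : F y = 0) (h1 : ∀ i, pd i F y = 0) : ∀ᶠ z in 𝓝[range (𝓡∂ n)] y, F z = 0 := by
  choose K hK0 hK using fun i j => (hO i j).exists_nonneg
  simp only [IsBigOWith] at hK
  obtain ⟨r, hr, hb⟩ := hS.exists_ball hy (eventually_all.mpr fun i => eventually_all.mpr (hK i))
  refine mem_of_superset (inter_mem (mem_nhdsWithin_of_mem_nhds (Metric.ball_mem_nhds y hr))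
    self_mem_nhdsWithin) fun z hz => ?_
  have hconv : Convex ℝ (Metric.ball y r ∩ range (𝓡∂ n)) :=
    (convex_ball y r).inter (𝓡∂ n).convex_range
  have hyb : y ∈ Metric.ball y r ∩ range (𝓡∂ n) := ⟨Metric.mem_ball_self hr, hS.subset hy⟩
  -- Along the segment from `y` to `z` the 1-jet `J` of `F` satisfies $\|J'\|\le C\|J\|$ with
  -- $J(0)=0$, so Grönwall's inequality kills it.
  set γ : ℝ → EuclideanSpace ℝ (Fin n) := fun t => y + t • (z - y) with hγ
  have hγm : ∀ t ∈ Icc (0 : ℝ) 1, γ t ∈ Metric.ball y r ∩ range (𝓡∂ n) := fun t ht =>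
    hconv.add_smul_sub_mem hyb hz ht
  have hγd : ∀ t, HasDerivAt γ (z - y) t := fun t => by
    have := ((hasDerivAt_id t).smul_const (z - y)).const_add y
    rwa [one_smul] at this
  have hcomp : ∀ F' : EuclideanSpace ℝ (Fin n) → ℝ, ContDiffOn ℝ ∞ F' S → ∀ t ∈ Icc (0 : ℝ) 1,
      HasDerivWithinAt (fun s => F' (γ s)) (∑ i, (z - y) i * pd i F' (γ t)) (Icc 0 1) t := by
    intro F' hF' t ht
    rw [← fderivWithin_apply_eq_sum_pd]
    exact (hS.differentiableWithinAt hF' (hb _ (hγm t ht)).1).hasFDerivWithinAt.comp_hasDerivWithinAt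
      t (hγd t).hasDerivWithinAt fun s hs => (hγm s hs).2
  set J : ℝ → ℝ × (Fin n → ℝ) := fun t => (F (γ t), fun j => pd j F (γ t)) with hJ
  set J' : ℝ → ℝ × (Fin n → ℝ) := fun t => (∑ i, (z - y) i * pd i F (γ t),
    fun j => ∑ i, (z - y) i * pd i (pd j F) (γ t)) with hJ'
  have hJd : ∀ t ∈ Icc (0 : ℝ) 1, HasDerivWithinAt J (J' t) (Icc 0 1) t := fun t ht =>
    (hcomp F hF t ht).prodMk (hasDerivWithinAt_pi.mpr fun j => hcomp _ (hS.contDiffOn_pd hF j) t ht)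
  have hv : ∀ i, |(z - y) i| ≤ ‖z - y‖ := fun i => by
    simpa using PiLp.norm_apply_le (z - y) i
  have hJF : ∀ t, |F (γ t)| ≤ ‖J t‖ := fun t => norm_fst_le (J t)
  have hJp : ∀ t j, |pd j F (γ t)| ≤ ‖J t‖ := fun t j =>
    (norm_le_pi_norm (J t).2 j).trans (norm_snd_le (J t))
  set N : ℝ := ∑ _i : Fin n, ‖z - y‖ with hN
  -- The factor $1+n$ arises from $|F|+\sum_k|\partial_kF|\le(1+n)\|J\|$; summing over both indices
  -- makes one constant serve every component.
  set B : ℝ := ∑ i, ∑ j, ‖z - y‖ * (K i j * (1 + ∑ _k : Fin n, 1)) with hB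
  have hterm0 : ∀ i j, 0 ≤ ‖z - y‖ * (K i j * (1 + ∑ _k : Fin n, 1)) := fun i j =>
    mul_nonneg (norm_nonneg _) (mul_nonneg (hK0 i j) (by positivity))
  have hN0 : 0 ≤ N := Finset.sum_nonneg fun _ _ => norm_nonneg _
  have hB0 : 0 ≤ B := Finset.sum_nonneg fun i _ => Finset.sum_nonneg fun j _ => hterm0 i j
  have hbound : ∀ t ∈ Ico (0 : ℝ) 1, ‖J' t‖ ≤ (N + B) * ‖J t‖ + 0 := by
    intro t ht
    have htm := hb _ (hγm t ⟨ht.1, ht.2.le⟩)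
    rw [add_zero, add_mul]
    have hJ0 := norm_nonneg (J t)
    refine norm_prod_le_iff.mpr ⟨?_, ?_⟩
    · refine le_trans ?_ (le_add_of_nonneg_right (mul_nonneg hB0 hJ0))
      change ‖∑ i, (z - y) i * pd i F (γ t)‖ ≤ _
      rw [hN, Finset.sum_mul]
      refine (norm_sum_le _ _).trans (Finset.sum_le_sum fun i _ => ?_)
      rw [norm_mul]
      exact mul_le_mul (hv i) (hJp t i) (norm_nonneg _) (norm_nonneg _)
    · refine le_trans ?_ (le_add_of_nonneg_left (mul_nonneg hN0 hJ0))
      refine (pi_norm_le_iff_of_nonneg (mul_nonneg hB0 hJ0)).mpr fun j => ?_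
      change ‖∑ i, (z - y) i * pd i (pd j F) (γ t)‖ ≤ _
      rw [hB, Finset.sum_mul]
      refine (norm_sum_le _ _).trans (Finset.sum_le_sum fun i _ => ?_)
      refine le_trans ?_ (mul_le_mul_of_nonneg_right
        (Finset.single_le_sum (fun j _ => hterm0 i j) (Finset.mem_univ j)) hJ0)
      rw [norm_mul, mul_assoc]
      refine mul_le_mul (hv i) ?_ (norm_nonneg _) (norm_nonneg _)
      refine (htm.2 i j).trans ?_
      rw [mul_assoc]
      refine mul_le_mul_of_nonneg_left ?_ (hK0 i j)
      rw [Real.norm_of_nonneg (by positivity), add_mul, one_mul, Finset.sum_mul]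
      refine add_le_add (hJF t) (Finset.sum_le_sum fun k _ => ?_)
      rw [one_mul]
      exact hJp t k
  have hcont : ContinuousOn J (Icc 0 1) := fun t ht => (hJd t ht).continuousWithinAt
  have hderiv : ∀ t ∈ Ico (0 : ℝ) 1, HasDerivWithinAt J (J' t) (Ici t) t := fun t ht =>
    (hJd t ⟨ht.1, ht.2.le⟩).mono_of_mem_nhdsWithin
      (mem_of_superset (Icc_mem_nhdsGE ht.2) (Icc_subset_Icc_left ht.1))
  have hJ0 : ‖J 0‖ ≤ 0 := by
    have : J 0 = 0 := by
      simp only [hJ, hγ, zero_smul, add_zero, h0, h1]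
      rfl
    rw [this, norm_zero]
  have := norm_le_gronwallBound_of_norm_deriv_right_le hcont hderiv hJ0 hbound 1
    (right_mem_Icc.mpr zero_le_one)
  rw [gronwallBound_ε0_δ0] at this
  have h2 := (hJF 1).trans this
  have h3 : γ 1 = z := by simp [hγ]
  rw [h3] at h2
  exact abs_nonpos_iff.mp h2

end LocalAnalysis

/-! ### Local consequences of the kernel equation -/

section KernelEquation

open Filter Topology Asymptotics

variable {n : ℕ} [NeZero n] {S : Set (EuclideanSpace ℝ (Fin n))}

theorem IsRelOpen.tendsto (hS : IsRelOpen S) {P : EuclideanSpace ℝ (Fin n) → ℝ}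
    (hP : ContDiffOn ℝ ∞ P S) {y : EuclideanSpace ℝ (Fin n)} (hy : y ∈ S) :
    Tendsto P (𝓝[range (𝓡∂ n)] y) (𝓝 (P y)) :=
  (hS.contDiffWithinAt hP hy).continuousWithinAt

theorem IsRelOpen.eq_zero_of_frequently (hS : IsRelOpen S) {P : EuclideanSpace ℝ (Fin n) → ℝ}
    (hP : ContDiffOn ℝ ∞ P S) {y : EuclideanSpace ℝ (Fin n)} (hy : y ∈ S)
    (h : ∃ᶠ z in 𝓝[range (𝓡∂ n)] y, P z = 0) : P y = 0 :=
  isClosed_singleton.mem_of_frequently_of_tendsto (s := {(0 : ℝ)}) h (hS.tendsto hP hy)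

theorem IsRelOpen.mul_isBigO (hS : IsRelOpen S) {a P J : EuclideanSpace ℝ (Fin n) → ℝ}
    (ha : ContDiffOn ℝ ∞ a S) {y : EuclideanSpace ℝ (Fin n)} (hy : y ∈ S)
    (hP : P =O[𝓝[range (𝓡∂ n)] y] J) :
    (fun z => a z * P z) =O[𝓝[range (𝓡∂ n)] y] J := by
  simpa using ((hS.tendsto ha hy).isBigO_one ℝ).mul hP

theorem isBigO_jet (F : EuclideanSpace ℝ (Fin n) → ℝ) (l : Filter (EuclideanSpace ℝ (Fin n))) :
    F =O[l] fun z => |F z| + ∑ k, |pd k F z| :=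
  IsBigO.of_bound 1 <| Eventually.of_forall fun z => by
    have : 0 ≤ ∑ k, |pd k F z| := Finset.sum_nonneg fun _ _ => abs_nonneg _
    rw [one_mul, Real.norm_eq_abs, Real.norm_of_nonneg (by positivity)]
    linarith

theorem pd_isBigO_jet (F : EuclideanSpace ℝ (Fin n) → ℝ) (i : Fin n)
    (l : Filter (EuclideanSpace ℝ (Fin n))) :
    pd i F =O[l] fun z => |F z| + ∑ k, |pd k F z| :=
  IsBigO.of_bound 1 <| Eventually.of_forall fun z => by
    have h1 : |pd i F z| ≤ ∑ k, |pd k F z| :=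
      Finset.single_le_sum (f := fun k => |pd k F z|) (fun _ _ => abs_nonneg _)
        (Finset.mem_univ i)
    have h2 := abs_nonneg (F z)
    rw [one_mul, Real.norm_eq_abs, Real.norm_of_nonneg (by positivity)]
    linarith

variable {G : EuclideanSpace ℝ (Fin n) → Matrix (Fin n) (Fin n) ℝ}
  {f u : EuclideanSpace ℝ (Fin n) → ℝ} {c : ℝ} {y : EuclideanSpace ℝ (Fin n)}

theorem pd_eq_zero_of_locally_const (hy : y ∈ range (𝓡∂ n))
    (hc : ∀ᶠ z in 𝓝[range (𝓡∂ n)] y, f z = f y) (i : Fin n) : pd i f y = 0 := by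
  rw [pd_congr_of_eventuallyEq hy (F' := fun _ => f y) hc, pd_const]

theorem eventually_locally_const (hc : ∀ᶠ z in 𝓝[range (𝓡∂ n)] y, f z = f y) :
    ∀ᶠ z in 𝓝[range (𝓡∂ n)] y, ∀ᶠ w in 𝓝[range (𝓡∂ n)] z, f w = f z := by
  have h2 := eventually_eventually_nhdsWithin.mpr hc
  filter_upwards [hc, h2] with z h1 h2
  filter_upwards [h2] with w hw
  rw [hw, h1]

theorem hessian_eq_zero_of_locally_const (hy : y ∈ range (𝓡∂ n))
    (hc : ∀ᶠ z in 𝓝[range (𝓡∂ n)] y, f z = f y) (i j : Fin n) : hessian G f i j y = 0 := by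
  have h1 : pd j f =ᶠ[𝓝[range (𝓡∂ n)] y] fun _ => 0 := by
    filter_upwards [eventually_locally_const hc, self_mem_nhdsWithin] with z hz hz'
    exact pd_eq_zero_of_locally_const hz' hz j
  rw [hessian, pd_congr_of_eventuallyEq hy h1, pd_const]
  simp [pd_eq_zero_of_locally_const hy hc]

theorem scalarCurvature_eq_of_locally_const (hy : y ∈ range (𝓡∂ n))
    (hc : ∀ᶠ z in 𝓝[range (𝓡∂ n)] y, f z = f y) (hR : perelmanScalar G f y = c) :
    scalarCurvature G y = c := by
  rw [← hR]
  simp [perelmanScalar, laplacian, gradNormSq, hessian_eq_zero_of_locally_const hy hc,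
    pd_eq_zero_of_locally_const hy hc]

/-! ### Vanishing of $\Delta_fu$ and closure of the kernel equation on 1-jets. -/

namespace IsSmoothMetric

/-- Eliminates $\Delta u$ between the trace of the kernel equation and $\Delta_fu=\Delta
u-\langle\nabla f,\nabla u\rangle$; no second derivative of `u` is left on the right. -/
theorem sub_one_mul_driftLaplacian (hG : IsSmoothMetric S G) (hf : ContDiffOn ℝ ∞ f S)
    (hu : ContDiffOn ℝ ∞ u S) (hE : ∀ y ∈ S, ∀ i j, perelmanAdjoint G f u i j y = 0)
    (hy : y ∈ S) : (n - 1) * driftLaplacian G f u y =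
      ∑ k, pd k f y * grad G u k y - u y * (scalarCurvature G y + laplacian G f y) := by
  have h1 := hG.mul_driftLaplacian_eq hy (hE y hy)
  have h2 := hG.driftLaplacian_eq hf hu hy
  linarith

/-- Such a point is a limit of points with $df\ne0$. Near each of those $\Delta_fu$ vanishes
identically, hence with its derivatives, and continuity passes this to the limit. -/
theorem driftLaplacian_eq_zero_of_not_locally_const (hG : IsSmoothMetric S G)
    (hf : ContDiffOn ℝ ∞ f S)
    (hu : ContDiffOn ℝ ∞ u S) (hR : ∀ y ∈ S, perelmanScalar G f y = c)
    (hE : ∀ y ∈ S, ∀ i j, perelmanAdjoint G f u i j y = 0) (hy : y ∈ S)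
    (hc : ¬ ∀ᶠ z in 𝓝[range (𝓡∂ n)] y, f z = f y) :
    driftLaplacian G f u y = 0 ∧ ∀ i, pd i (driftLaplacian G f u) y = 0 := by
  have hS := hG.isRelOpen
  have hh := hG.contDiffOn_driftLaplacian hf hu
  have key : ∃ᶠ z in 𝓝[range (𝓡∂ n)] y, driftLaplacian G f u z = 0 ∧
      ∀ i, pd i (driftLaplacian G f u) z = 0 := by
    refine (hS.frequently_pd_ne_zero hf hy hc).mono fun z ⟨hz, j, hj⟩ => ?_
    have h1 : driftLaplacian G f u =ᶠ[𝓝[range (𝓡∂ n)] z] fun _ => 0 := by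
      filter_upwards [(hS.tendsto (hS.contDiffOn_pd hf j) hz).eventually_ne hj,
        hS.mem_nhdsWithin z hz] with w hw hwS
      exact (mul_eq_zero.mp (hG.driftLaplacian_mul_pd_eq_zero hf hu hR hE hwS j)).resolve_right hw
    exact ⟨h1.self_of_nhdsWithin (hS.subset hz), fun i => by
      rw [pd_congr_of_eventuallyEq (hS.subset hz) h1, pd_const]⟩
  exact ⟨hS.eq_zero_of_frequently hh hy (key.mono fun z hz => hz.1), fun i =>
    hS.eq_zero_of_frequently (hS.contDiffOn_pd hh i) hy (key.mono fun z hz => hz.2 i)⟩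

theorem sub_one_mul_driftLaplacian_of_locally_const (hG : IsSmoothMetric S G)
    (hf : ContDiffOn ℝ ∞ f S)
    (hu : ContDiffOn ℝ ∞ u S) (hR : ∀ y ∈ S, perelmanScalar G f y = c)
    (hE : ∀ y ∈ S, ∀ i j, perelmanAdjoint G f u i j y = 0) (hy : y ∈ S)
    (hc : ∀ᶠ z in 𝓝[range (𝓡∂ n)] y, f z = f y) :
    (n - 1) * driftLaplacian G f u y + c * u y = 0 := by
  have hy' := hG.isRelOpen.subset hy
  rw [hG.sub_one_mul_driftLaplacian hf hu hE hy,
    scalarCurvature_eq_of_locally_const hy' hc (hR y hy)]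
  simp [laplacian, hessian_eq_zero_of_locally_const hy' hc, pd_eq_zero_of_locally_const hy' hc]
  ring

/-- At a frontier point of the region where `f` is locally constant, `u` vanishes to first
order. -/
theorem jet_eq_zero_of_frequently_locally_const (hG : IsSmoothMetric S G)
    (hf : ContDiffOn ℝ ∞ f S)
    (hu : ContDiffOn ℝ ∞ u S) (hR : ∀ y ∈ S, perelmanScalar G f y = c) (hc0 : c ≠ 0)
    (hE : ∀ y ∈ S, ∀ i j, perelmanAdjoint G f u i j y = 0) (hy : y ∈ S)
    (hc : ¬ ∀ᶠ z in 𝓝[range (𝓡∂ n)] y, f z = f y)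
    (hc' : ∃ᶠ z in 𝓝[range (𝓡∂ n)] y, ∀ᶠ w in 𝓝[range (𝓡∂ n)] z, f w = f z) :
    u y = 0 ∧ ∀ i, pd i u y = 0 := by
  have hS := hG.isRelOpen
  have hh := hG.contDiffOn_driftLaplacian hf hu
  obtain ⟨h0, h1⟩ := hG.driftLaplacian_eq_zero_of_not_locally_const hf hu hR hE hy hc
  -- `P` vanishes on the region where `f` is locally constant, so its 1-jet is zero at `y`. The
  -- 1-jet of $\Delta_fu$ is zero there too, which leaves that of $cu$.
  set P : EuclideanSpace ℝ (Fin n) → ℝ := fun z => (n - 1) * driftLaplacian G f u z + c * u z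
    with hP
  have hPd : ContDiffOn ℝ ∞ P S := (contDiffOn_const.mul hh).add (contDiffOn_const.mul hu)
  have key : ∃ᶠ z in 𝓝[range (𝓡∂ n)] y, P z = 0 ∧ ∀ i, pd i P z = 0 := by
    refine (hc'.and_eventually (hS.mem_nhdsWithin y hy)).mono fun z ⟨hz, hzS⟩ => ?_
    have h1 : P =ᶠ[𝓝[range (𝓡∂ n)] z] fun _ => 0 := by
      filter_upwards [eventually_locally_const hz, hS.mem_nhdsWithin z hzS] with w hw hwS
      exact hG.sub_one_mul_driftLaplacian_of_locally_const hf hu hR hE hwS hw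
    exact ⟨h1.self_of_nhdsWithin (hS.subset hzS), fun i => by
      rw [pd_congr_of_eventuallyEq (hS.subset hzS) h1, pd_const]⟩
  have hP0 := hS.eq_zero_of_frequently hPd hy (key.mono fun z hz => hz.1)
  have hP1 := fun i => hS.eq_zero_of_frequently (hS.contDiffOn_pd hPd i) hy
    (key.mono fun z hz => hz.2 i)
  refine ⟨?_, fun i => ?_⟩
  · simpa [hP, h0, hc0] using hP0
  · have hd1 := hS.differentiableWithinAt hh hy
    have hd2 := hS.differentiableWithinAt hu hy
    have := hP1 i
    rw [hP, pd_add (hS.subset hy) (hd1.const_mul _) (hd2.const_mul _),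
      pd_const_mul _ (hS.subset hy) hd1, pd_const_mul _ (hS.subset hy) hd2, h1] at this
    simpa [hc0] using this

/-- In dimension at least two, the kernel equation controls the second derivatives of `u` by its
1-jet. -/
theorem pd_pd_isBigO_of_kernel (hG : IsSmoothMetric S G) (hn : n ≠ 1) (hf : ContDiffOn ℝ ∞ f S)
    (hu : ContDiffOn ℝ ∞ u S) (hE : ∀ y ∈ S, ∀ i j, perelmanAdjoint G f u i j y = 0)
    (hy : y ∈ S) (i j : Fin n) :
    pd i (pd j u) =O[𝓝[range (𝓡∂ n)] y] fun z => |u z| + ∑ k, |pd k u z| := by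
  have hS := hG.isRelOpen
  have hf' := represents_toSmooth f hf
  have hn1 : (n : ℝ) - 1 ≠ 0 := sub_ne_zero.mpr (by exact_mod_cast hn)
  have hh : driftLaplacian G f u =O[𝓝[range (𝓡∂ n)] y] fun z => |u z| + ∑ k, |pd k u z| := by
    have h1 : (fun z => ((n : ℝ) - 1)⁻¹ * (∑ k, pd k f z * ∑ j, (G z)⁻¹ k j * pd j u z -
        (scalarCurvature G z + laplacian G f z) * u z))
        =O[𝓝[range (𝓡∂ n)] y] fun z => |u z| + ∑ k, |pd k u z| :=
      (((IsBigO.fun_sum fun k _ => hS.mul_isBigO (hS.contDiffOn_pd hf k) hy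
        (IsBigO.fun_sum fun j _ => hS.mul_isBigO (hG.represents_inv k j).contDiffOn hy
          (pd_isBigO_jet u j _))).sub (hS.mul_isBigO
          (hG.represents_scalarCurvature.add (hG.represents_laplacian hf')).contDiffOn hy
          (isBigO_jet u _))).const_mul_left _)
    refine h1.congr' ?_ EventuallyEq.rfl
    filter_upwards [hS.mem_nhdsWithin y hy] with z hz
    have := hG.sub_one_mul_driftLaplacian hf hu hE hz
    rw [inv_mul_eq_iff_eq_mul₀ hn1, this]
    simp only [grad]
    ring
  have h2 : (fun z => G z i j * driftLaplacian G f u z + ricciWeighted G f i j z * u z +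
      ∑ k, christoffel G k i j z * pd k u z)
      =O[𝓝[range (𝓡∂ n)] y] fun z => |u z| + ∑ k, |pd k u z| :=
    ((hS.mul_isBigO (hG.contDiffOn i j) hy hh).add (hS.mul_isBigO
      ((hG.represents_ricci i j).add (hG.represents_hessian hf' i j)).contDiffOn hy
      (isBigO_jet u _))).add (IsBigO.fun_sum fun k _ =>
      hS.mul_isBigO (hG.represents_christoffel k i j).contDiffOn hy (pd_isBigO_jet u k _))
  refine h2.congr' ?_ EventuallyEq.rfl
  filter_upwards [hS.mem_nhdsWithin y hy] with z hz
  have := hE z hz i j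
  rw [perelmanAdjoint, hessian] at this
  linarith

theorem ricci_eq_zero_of_dim_one (hn : n = 1)
    (G : EuclideanSpace ℝ (Fin n) → Matrix (Fin n) (Fin n) ℝ)
    (i j : Fin n) (y : EuclideanSpace ℝ (Fin n)) : ricci G i j y = 0 := by
  have : Subsingleton (Fin n) := by subst hn; infer_instance
  rw [ricci, Finset.sum_eq_zero, Finset.sum_eq_zero, add_zero]
  · exact fun k _ => Finset.sum_eq_zero fun l _ => by
      rw [Subsingleton.elim j k, Subsingleton.elim l k, Subsingleton.elim i k]; ring
  · exact fun k _ => by rw [Subsingleton.elim j k]; ring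

/-- In dimension one, vanishing Perelman scalar curvature controls the second derivative of `f`
by its first. -/
theorem pd_pd_isBigO_of_dim_one (hG : IsSmoothMetric S G) (hn : n = 1) (hf : ContDiffOn ℝ ∞ f S)
    (hR : ∀ y ∈ S, perelmanScalar G f y = 0) (a : ℝ) (hy : y ∈ S) (i j : Fin n) :
    pd i (pd j fun z => f z - a) =O[𝓝[range (𝓡∂ n)] y]
      fun z => |f z - a| + ∑ k, |pd k (fun z => f z - a) z| := by
  have hss : Subsingleton (Fin n) := by subst hn; infer_instance
  have hS := hG.isRelOpen
  have hpd : ∀ k, pd k (fun z => f z - a) = pd k f := fun k => by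
    funext z
    rw [pd, fderivWithin_sub_const]; rfl
  have hO := fun k => pd_isBigO_jet (fun z => f z - a) k (𝓝[range (𝓡∂ n)] y)
  simp only [hpd] at hO ⊢
  -- With $R=0$ and a single component, $2\Delta f=|\nabla f|^2$ reads $\nabla^2f=\tfrac12|\nabla
  -- f|^2g$. The right side is quadratic in $df$; one factor is absorbed into the bounded
  -- coefficient.
  have h2 : (fun z => (1 / 2 * G z i j) * (∑ k, ∑ l, ((G z)⁻¹ k l * pd k f z) * pd l f z) +
      ∑ k, christoffel G k i j z * pd k f z)
      =O[𝓝[range (𝓡∂ n)] y] fun z => |f z - a| + ∑ k, |pd k f z| :=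
    (hS.mul_isBigO (contDiffOn_const.mul (hG.contDiffOn i j)) hy (IsBigO.fun_sum fun k _ =>
      IsBigO.fun_sum fun l _ => hS.mul_isBigO ((hG.represents_inv k l).contDiffOn.mul
      (hS.contDiffOn_pd hf k)) hy (hO l))).add (IsBigO.fun_sum fun k _ =>
      hS.mul_isBigO (hG.represents_christoffel k i j).contDiffOn hy (hO k))
  refine h2.congr' ?_ EventuallyEq.rfl
  filter_upwards [hS.mem_nhdsWithin y hy] with z hz
  have hRz := hR z hz
  have hinv : (G z)⁻¹ i j * G z i j = 1 := by
    have h1 := congrFun (congrFun (Matrix.nonsing_inv_mul (G z)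
      (isUnit_iff_ne_zero.mpr (hG.posDef z hz).det_pos.ne')) i) j
    have huniv : (Finset.univ : Finset (Fin n)) = {i} := by
      ext k; simp [Subsingleton.elim k i]
    rw [Matrix.mul_apply, huniv, Finset.sum_singleton] at h1
    rw [Subsingleton.elim j i] at h1 ⊢
    simpa using h1
  have hlap : laplacian G f z = (G z)⁻¹ i j * hessian G f i j z := by
    have huniv : (Finset.univ : Finset (Fin n)) = {i} := by
      ext k; simp [Subsingleton.elim k i]
    rw [laplacian, huniv, Finset.sum_singleton, Finset.sum_singleton, Subsingleton.elim j i]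
  have hsc : scalarCurvature G z = 0 := by
    simp [scalarCurvature, ricci_eq_zero_of_dim_one hn]
  have hh : pd i (pd j f) z = hessian G f i j z + ∑ k, christoffel G k i j z * pd k f z := by
    rw [hessian]; ring
  rw [perelmanScalar, hsc, hlap, gradNormSq] at hRz
  rw [hh]
  congr 1
  have e : ∑ k, ∑ l, (G z)⁻¹ k l * pd k f z * pd l f z = 2 * ((G z)⁻¹ i j * hessian G f i j z) := by
    linarith
  rw [e]
  linear_combination hessian G f i j z * hinv

end IsSmoothMetric

end KernelEquation

/-! ### The strong maximum principle -/

section MaximumPrinciple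

open Filter Topology

variable {n : ℕ} [NeZero n] {O : Set (EuclideanSpace ℝ (Fin n))}

theorem isRelOpen_of_isOpen (hO : IsOpen O) (hR : O ⊆ range (𝓡∂ n)) : IsRelOpen O where
  subset := hR
  mem_nhdsWithin _ hy := mem_nhdsWithin_of_mem_nhds (hO.mem_nhds hy)

/-- Restrict to the line in direction `ξ`. A positive second derivative would make the point a local
minimum as well, so `v` would be constant along the line nearby and that derivative zero. -/
theorem second_derivative_test (hO : IsOpen O) (hR : O ⊆ range (𝓡∂ n))
    {v : EuclideanSpace ℝ (Fin n) → ℝ} (hv : ContDiffOn ℝ ∞ v O)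
    {x : EuclideanSpace ℝ (Fin n)} (hx : x ∈ O) (hmax : IsLocalMax v x)
    (ξ : Fin n → ℝ) :
    (∀ k, pd k v x = 0) ∧ ∑ i, ∑ j, ξ i * ξ j * pd i (pd j v) x ≤ 0 := by
  have hS := isRelOpen_of_isOpen hO hR
  have hnhds : ∀ z ∈ O, range (𝓡∂ n) ∈ 𝓝 z := fun z hz => mem_of_superset (hO.mem_nhds hz) hR
  refine ⟨fun k => ?_, ?_⟩
  · rw [pd, fderivWithin_of_mem_nhds (hnhds x hx), hmax.fderiv_eq_zero]
    rfl
  set η : EuclideanSpace ℝ (Fin n) := WithLp.toLp 2 ξ with hη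
  set γ : ℝ → EuclideanSpace ℝ (Fin n) := fun t => x + t • η with hγ
  have hγ0 : γ 0 = x := by simp [hγ]
  have hγd : ∀ t, HasDerivAt γ η t := fun t => by
    have := ((hasDerivAt_id t).smul_const η).const_add x
    rwa [one_smul] at this
  have hγc : ContinuousAt γ 0 := (hγd 0).continuousAt
  have hcomp : ∀ F : EuclideanSpace ℝ (Fin n) → ℝ, ContDiffOn ℝ ∞ F O → ∀ t, γ t ∈ O →
      HasDerivAt (fun s => F (γ s)) (∑ i, ξ i * pd i F (γ t)) t := by
    intro F hF t ht
    have h1 : HasFDerivAt F (fderivWithin ℝ F (range (𝓡∂ n)) (γ t)) (γ t) :=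
      (hS.differentiableWithinAt hF ht).hasFDerivWithinAt.hasFDerivAt (hnhds _ ht)
    have h2 := h1.comp_hasDerivAt t (hγd t)
    rw [fderivWithin_apply_eq_sum_pd] at h2
    exact h2
  have hev : ∀ᶠ t in 𝓝 (0 : ℝ), γ t ∈ O := hγc.eventually_mem (by
    rw [hγ0]; exact hO.mem_nhds hx)
  have hd1 : deriv (fun s => v (γ s)) =ᶠ[𝓝 0] fun t => ∑ j, ξ j * pd j v (γ t) := by
    filter_upwards [hev] with t ht using (hcomp v hv t ht).deriv
  have hd2 : HasDerivAt (fun t => ∑ j, ξ j * pd j v (γ t))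
      (∑ j, ξ j * ∑ i, ξ i * pd i (pd j v) (γ 0)) 0 :=
    HasDerivAt.fun_sum fun j _ => (hcomp _ (hS.contDiffOn_pd hv j) 0 (by rwa [hγ0])).const_mul _
  have hsum : ∑ i, ∑ j, ξ i * ξ j * pd i (pd j v) x =
      ∑ j, ξ j * ∑ i, ξ i * pd i (pd j v) (γ 0) := by
    rw [hγ0, Finset.sum_comm]
    simp only [Finset.mul_sum]
    exact Finset.sum_congr rfl fun _ _ => Finset.sum_congr rfl fun _ _ => by ring
  rw [hsum]
  by_contra! hpos
  have hdd : deriv (deriv fun s => v (γ s)) 0 = ∑ j, ξ j * ∑ i, ξ i * pd i (pd j v) (γ 0) := by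
    rw [hd1.deriv_eq, hd2.deriv]
  have hmax' : IsLocalMax (fun s => v (γ s)) 0 := by
    have := hγc.tendsto
    rw [hγ0] at this
    filter_upwards [this.eventually hmax] with t ht
    rwa [hγ0]
  have hmin : IsLocalMin (fun s => v (γ s)) 0 :=
    isLocalMin_of_deriv_deriv_pos (by rwa [hdd]) hmax'.deriv_eq_zero
      (hcomp v hv 0 (by rwa [hγ0])).continuousAt
  have hconst : (fun s => v (γ s)) =ᶠ[𝓝 0] fun _ => v (γ 0) := by
    filter_upwards [hmax', hmin] with t h1 h2 using le_antisymm h1 h2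
  have h0 : deriv (deriv fun s => v (γ s)) 0 = 0 := by
    rw [hconst.deriv.deriv_eq]
    simp
  rw [hdd] at h0
  exact hpos.ne' h0

/-- Writing $A=B^*B$ splits the contraction into values of the quadratic form of `H` on the rows of
`B`. -/
theorem sum_mul_nonpos_of_posSemidef {A : Matrix (Fin n) (Fin n) ℝ} (hA : A.PosSemidef)
    {H : Fin n → Fin n → ℝ} (hH : ∀ ξ : Fin n → ℝ, ∑ i, ∑ j, ξ i * ξ j * H i j ≤ 0) :
    ∑ i, ∑ j, A i j * H i j ≤ 0 := by
  obtain ⟨B, rfl⟩ : ∃ B : Matrix (Fin n) (Fin n) ℝ, A = B.conjTranspose * B := by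
    open scoped MatrixOrder in
    exact CStarAlgebra.nonneg_iff_eq_star_mul_self.mp hA.nonneg
  have : ∑ i, ∑ j, (B.conjTranspose * B) i j * H i j =
      ∑ k, ∑ i, ∑ j, B k i * B k j * H i j := by
    simp only [Matrix.mul_apply, Matrix.conjTranspose_apply, star_trivial, Finset.sum_mul]
    rw [Finset.sum_comm' (t' := Finset.univ) (s' := fun _ => Finset.univ) (by simp)]
    rw [Finset.sum_comm]
    refine (Finset.sum_congr rfl fun i _ => Finset.sum_comm).trans ?_
    rw [Finset.sum_comm]
  rw [this]
  exact Finset.sum_nonpos fun k _ => hH (B k)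

/-! ### Hopf's barrier argument. -/

variable {z : EuclideanSpace ℝ (Fin n)} {α : ℝ}

/-- The barrier function `exp (-α |x - z|²)`. -/
def barrier (z : EuclideanSpace ℝ (Fin n)) (α : ℝ) (x : EuclideanSpace ℝ (Fin n)) : ℝ :=
  Real.exp (-(α * ‖x - z‖ ^ 2))

theorem contDiff_barrier : ContDiff ℝ ∞ (barrier z α) :=
  ((contDiff_const.mul ((contDiff_id.sub contDiff_const).norm_sq ℝ)).neg).exp

theorem pd_barrier {x : EuclideanSpace ℝ (Fin n)} (hx : x ∈ range (𝓡∂ n)) (i : Fin n) :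
    pd i (barrier z α) x = (-2 * α * (x i - z i)) * barrier z α x := by
  have h1 : HasFDerivAt (fun x : EuclideanSpace ℝ (Fin n) => x - z) (.id ℝ _) x :=
    (hasFDerivAt_id x).sub_const z
  have h2 : HasFDerivAt (barrier z α) _ x := ((h1.norm_sq.const_mul α).neg).exp
  rw [pd, h2.hasFDerivWithinAt.fderivWithin ((𝓡∂ n).uniqueDiffOn x hx)]
  simp [barrier, EuclideanSpace.inner_single_right]
  ring

theorem differentiable_coord (j : Fin n) :
    Differentiable ℝ fun x : EuclideanSpace ℝ (Fin n) => x j :=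
  (EuclideanSpace.proj j : EuclideanSpace ℝ (Fin n) →L[ℝ] ℝ).differentiable

theorem pd_coord_sub {x : EuclideanSpace ℝ (Fin n)} (hx : x ∈ range (𝓡∂ n)) (i j : Fin n) (c : ℝ) :
    pd i (fun x => c * (x j - z j)) x = c * if i = j then 1 else 0 := by
  have h1 : HasFDerivAt (fun x : EuclideanSpace ℝ (Fin n) => x j)
      (EuclideanSpace.proj j : EuclideanSpace ℝ (Fin n) →L[ℝ] ℝ) x :=
    (EuclideanSpace.proj j : EuclideanSpace ℝ (Fin n) →L[ℝ] ℝ).hasFDerivAt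
  have h2 := ((h1.sub_const (z j)).const_mul c)
  rw [pd, HasFDerivWithinAt.fderivWithin h2.hasFDerivWithinAt ((𝓡∂ n).uniqueDiffOn x hx)]
  simp [eq_comm]

theorem pd_pd_barrier (hO : IsOpen O) (hR : O ⊆ range (𝓡∂ n))
    {x : EuclideanSpace ℝ (Fin n)} (hx : x ∈ O) (i j : Fin n) :
    pd i (pd j (barrier z α)) x = (4 * α ^ 2 * ((x i - z i) * (x j - z j)) -
      2 * α * if i = j then 1 else 0) * barrier z α x := by
  have hS := isRelOpen_of_isOpen hO hR
  have hb : DifferentiableWithinAt ℝ (barrier z α) (range (𝓡∂ n)) x :=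
    (contDiff_barrier.differentiable (by simp)).differentiableAt.differentiableWithinAt
  have hc : DifferentiableWithinAt ℝ (fun x : EuclideanSpace ℝ (Fin n) => -2 * α * (x j - z j))
      (range (𝓡∂ n)) x :=
    (((differentiable_coord j).sub_const _).const_mul _).differentiableAt.differentiableWithinAt
  have h1 : EqOn (pd j (barrier z α)) (fun x => (-2 * α * (x j - z j)) * barrier z α x) O :=
    fun w hw => pd_barrier (hR hw) j
  rw [hS.pd_congr h1 i hx, pd_mul (hR hx) hc hb, pd_barrier (hR hx), pd_coord_sub (hR hx)]
  ring

/-- A solution of `a^{ij} ∂_i ∂_j u + b^k ∂_k u = 0` cannot touch its maximum `m` at exactly one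
point of a closed ball on whose boundary that point lies. -/
theorem no_touching_point (hO : IsOpen O) (hR : O ⊆ range (𝓡∂ n))
    {a : EuclideanSpace ℝ (Fin n) → Matrix (Fin n) (Fin n) ℝ}
    {b : Fin n → EuclideanSpace ℝ (Fin n) → ℝ} {u : EuclideanSpace ℝ (Fin n) → ℝ} {m : ℝ}
    (ha : ∀ x ∈ O, (a x).PosDef) (hac : ∀ i j, ContinuousOn (fun x => a x i j) O)
    (hbc : ∀ k, ContinuousOn (b k) O) (hu : ContDiffOn ℝ ∞ u O)
    (hL : ∀ x ∈ O, ∑ i, ∑ j, a x i j * pd i (pd j u) x + ∑ k, b k x * pd k u x = 0)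
    (hle : ∀ x ∈ O, u x ≤ m) {q : EuclideanSpace ℝ (Fin n)} (hq : q ∈ O) (huq : u q = m) (hqz : q ≠ z)
    (hlt : ∀ x ∈ O, x ≠ q → ‖x - z‖ ≤ ‖q - z‖ → u x < m) : False := by
  have hS := isRelOpen_of_isOpen hO hR
  set Q : EuclideanSpace ℝ (Fin n) → ℝ := fun x =>
    ∑ i, ∑ j, a x i j * ((x i - z i) * (x j - z j)) with hQ
  set T : EuclideanSpace ℝ (Fin n) → ℝ := fun x =>
    ∑ i, a x i i + ∑ k, b k x * (x k - z k) with hT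
  have hQc : ContinuousOn Q O := continuousOn_finsetSum _ fun i _ =>
    continuousOn_finsetSum _ fun j _ => (hac i j).mul (by fun_prop)
  have hTc : ContinuousOn T O := (continuousOn_finsetSum _ fun i _ => hac i i).add
    (continuousOn_finsetSum _ fun k _ => (hbc k).mul (by fun_prop))
  have hQpos : 0 < Q q := by
    have h1 : (fun i => q i - z i) ≠ 0 := fun h0 => hqz (by
      ext i; exact sub_eq_zero.mp (congrFun h0 i))
    have h2 := (ha q hq).dotProduct_mulVec_pos h1
    have h3 : Q q = star (fun i => q i - z i) ⬝ᵥ (a q).mulVec fun i => q i - z i := by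
      simp only [hQ, dotProduct, Matrix.mulVec, star_trivial, Finset.mul_sum]
      exact Finset.sum_congr rfl fun _ _ => Finset.sum_congr rfl fun _ _ => by ring
    rwa [h3]
  -- The operator applied to the barrier gives $2\alpha(2\alpha Q-T)$ times the barrier. This choice
  -- makes $\alpha Q=|T|+1$ at `q`, so the bracket is positive there and on a small ball.
  set α : ℝ := (|T q| + 1) / Q q with hα
  have hα0 : 0 < α := by positivity
  have hΦq : 0 < 2 * α * Q q - T q := by
    have h1 : α * Q q = |T q| + 1 := by rw [hα]; field_simp
    have := le_abs_self (T q)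
    have := abs_nonneg (T q)
    nlinarith
  have hΦc : ContinuousAt (fun x => 2 * α * Q x - T x) q :=
    ((continuousOn_const.mul hQc).sub hTc).continuousAt (hO.mem_nhds hq)
  obtain ⟨ρ, hρ, hball⟩ := Metric.nhds_basis_closedBall.mem_iff.mp
    (inter_mem (hO.mem_nhds hq) (hΦc.eventually_const_lt hΦq))
  have hLw : ∀ x ∈ Metric.closedBall q ρ, 0 < ∑ i, ∑ j, a x i j * pd i (pd j (barrier z α)) x +
      ∑ k, b k x * pd k (barrier z α) x := by
    intro x hx
    have hxO := (hball hx).1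
    have hΦ : 0 < 2 * α * Q x - T x := (hball hx).2
    have : ∑ i, ∑ j, a x i j * pd i (pd j (barrier z α)) x +
        ∑ k, b k x * pd k (barrier z α) x = 2 * α * (2 * α * Q x - T x) * barrier z α x := by
      have e1 : ∑ i, ∑ j, a x i j * pd i (pd j (barrier z α)) x =
          4 * α ^ 2 * barrier z α x * Q x - 2 * α * barrier z α x * ∑ i, a x i i := by
        have e0 : ∑ i, a x i i = ∑ i, ∑ j, a x i j * if i = j then (1 : ℝ) else 0 := by simp
        simp only [e0, hQ, Finset.mul_sum, ← Finset.sum_sub_distrib]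
        refine Finset.sum_congr rfl fun i _ => Finset.sum_congr rfl fun j _ => ?_
        rw [pd_pd_barrier hO hR hxO]
        ring
      have e2 : ∑ k, b k x * pd k (barrier z α) x =
          -(2 * α * barrier z α x) * ∑ k, b k x * (x k - z k) := by
        rw [Finset.mul_sum]
        refine Finset.sum_congr rfl fun k _ => ?_
        rw [pd_barrier (hR hxO)]
        ring
      rw [e1, e2]
      simp only [hT]
      ring
    rw [this]
    exact mul_pos (mul_pos (by positivity) hΦ) (Real.exp_pos _)
  have hcb : Metric.closedBall q ρ ⊆ O := fun x hx => (hball hx).1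
  have huc : ContinuousOn u (Metric.closedBall q ρ) := hu.continuousOn.mono hcb
  obtain ⟨δ, hδ, hδm⟩ : ∃ δ > 0, ∀ x ∈ Metric.sphere q ρ ∩ Metric.closedBall z ‖q - z‖,
      u x ≤ m - δ := by
    rcases (Metric.sphere q ρ ∩ Metric.closedBall z ‖q - z‖).eq_empty_or_nonempty with he | hne
    · exact ⟨1, one_pos, fun x hx => by rw [he] at hx; exact hx.elim⟩
    · obtain ⟨x, hx, hxm⟩ := ((isCompact_sphere q ρ).inter_right
        Metric.isClosed_closedBall).exists_isMaxOn hne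
        (huc.mono (inter_subset_left.trans Metric.sphere_subset_closedBall))
      have hxq : x ≠ q := fun h => by
        have := hx.1
        rw [h, Metric.mem_sphere, dist_self] at this
        exact hρ.ne this
      have := hlt x (hcb (Metric.sphere_subset_closedBall hx.1)) hxq
        (by simpa [dist_eq_norm] using hx.2)
      exact ⟨m - u x, by linarith, fun w hw => by have : u w ≤ u x := hxm hw; linarith⟩
  -- The barrier is at most 1, so the perturbation cannot use up the gap `δ`.
  set ε := δ / 2 with hε
  have hε0 : 0 < ε := by positivity
  set v : EuclideanSpace ℝ (Fin n) → ℝ := fun x => u x + ε * barrier z α x with hv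
  have hbO : ContDiffOn ℝ ∞ (barrier z α) O := contDiff_barrier.contDiffOn
  have hvd : ContDiffOn ℝ ∞ v O := hu.add (contDiffOn_const.mul hbO)
  obtain ⟨x, hx, hxm⟩ := (isCompact_closedBall q ρ).exists_isMaxOn
    ⟨q, Metric.mem_closedBall_self hρ.le⟩ (hvd.continuousOn.mono hcb)
  have hxq : v q ≤ v x := hxm (Metric.mem_closedBall_self hρ.le)
  -- On the small sphere `v` stays below `v q`: inside the large ball because of the gap `δ`,
  -- outside it because $u\le m$ and the barrier is smaller than at `q`. The maximum is thus
  -- interior, which contradicts the operator being positive on `v`.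
  have hxball : x ∈ Metric.ball q ρ := by
    by_contra hxb
    have hsph : x ∈ Metric.sphere q ρ := by
      rw [Metric.mem_ball, not_lt] at hxb
      exact le_antisymm hx hxb
    have hvq : v q = m + ε * barrier z α q := by simp only [hv, huq]
    by_cases hxz : ‖x - z‖ ≤ ‖q - z‖
    · have h1 := hδm x ⟨hsph, by simpa [dist_eq_norm] using hxz⟩
      have h2 : barrier z α x ≤ 1 := Real.exp_le_one_iff.mpr (by
        have : 0 ≤ α * ‖x - z‖ ^ 2 := by positivity
        linarith)
      have h3 : 0 < barrier z α q := Real.exp_pos _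
      have h4 : v x ≤ m - δ + ε * 1 := add_le_add h1 (mul_le_mul_of_nonneg_left h2 hε0.le)
      have h5 : 0 < ε * barrier z α q := mul_pos hε0 h3
      linarith
    · push Not at hxz
      have h1 : barrier z α x < barrier z α q := by
        refine Real.exp_lt_exp.mpr (neg_lt_neg (mul_lt_mul_of_pos_left ?_ hα0))
        exact pow_lt_pow_left₀ hxz (norm_nonneg _) (by norm_num)
      have h2 := mul_lt_mul_of_pos_left h1 hε0
      have h3 : v x = u x + ε * barrier z α x := rfl
      have h4 := hle x (hcb hx)
      linarith
  have hlocal : IsLocalMax v x := by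
    filter_upwards [Metric.isOpen_ball.mem_nhds hxball] with w hw
    exact hxm (Metric.ball_subset_closedBall hw)
  have hxO := hcb hx
  have hp : ∀ k, EqOn (pd k v) (fun x => pd k u x + ε * pd k (barrier z α) x) O := fun k w hw => by
    have hd := hS.differentiableWithinAt hbO hw
    rw [hv, pd_add (hR hw) (hS.differentiableWithinAt hu hw) (hd.const_mul ε),
      pd_const_mul ε (hR hw) hd]
  have hpp : ∀ i j, pd i (pd j v) x = pd i (pd j u) x + ε * pd i (pd j (barrier z α)) x := by
    intro i j
    have hd := hS.differentiableWithinAt (hS.contDiffOn_pd hbO j) hxO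
    rw [hS.pd_congr (hp j) i hxO, pd_add (hR hxO)
      (hS.differentiableWithinAt (hS.contDiffOn_pd hu j) hxO) (hd.const_mul ε),
      pd_const_mul ε (hR hxO) hd]
  have htest := second_derivative_test hO hR hvd hxO hlocal
  have h1 := sum_mul_nonpos_of_posSemidef (ha x hxO).posSemidef fun ξ => (htest ξ).2
  have h2 : ∑ k, b k x * pd k v x = 0 :=
    Finset.sum_eq_zero fun k _ => by rw [(htest 0).1, mul_zero]
  have h3 : ∑ i, ∑ j, a x i j * pd i (pd j v) x + ∑ k, b k x * pd k v x =
      (∑ i, ∑ j, a x i j * pd i (pd j u) x + ∑ k, b k x * pd k u x) +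
      ε * (∑ i, ∑ j, a x i j * pd i (pd j (barrier z α)) x +
        ∑ k, b k x * pd k (barrier z α) x) := by
    simp only [hpp, hp _ hxO, mul_add, Finset.sum_add_distrib, Finset.mul_sum]
    simp only [mul_left_comm ε]
    ring
  have h4 := mul_pos hε0 (hLw x hx)
  rw [hL x hxO] at h3
  linarith

/-- The ball centred at the midpoint with `q` on its boundary is internally tangent at `q` to the
ball around `z₀`. Moving to it makes the touching point unique. -/
theorem norm_sub_lt_of_norm_sub_midpoint_le {x z₀ q : EuclideanSpace ℝ (Fin n)} (hxq : x ≠ q)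
    (h : ‖x - midpoint ℝ z₀ q‖ ≤ ‖q - midpoint ℝ z₀ q‖) : ‖x - z₀‖ < ‖q - z₀‖ := by
  set e := q - midpoint ℝ z₀ q with he
  set w := x - midpoint ℝ z₀ q with hw
  have he' : midpoint ℝ z₀ q - z₀ = e := by
    rw [he, midpoint_sub_left, right_sub_midpoint]
  have h1 : x - z₀ = w + e := by rw [← he', hw]; abel
  have h2 : q - z₀ = e + e := by
    calc q - z₀ = (q - midpoint ℝ z₀ q) + (midpoint ℝ z₀ q - z₀) := by abel
      _ = e + e := by rw [he']
  have h3 : x - q = w - e := by rw [hw, he]; abel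
  have h4 := parallelogram_law_with_norm ℝ w e
  have h5 : 0 < ‖w - e‖ := by
    rw [← h3]
    exact norm_pos_iff.mpr (sub_ne_zero.mpr hxq)
  have h6 : ‖e + e‖ = 2 * ‖e‖ := by rw [← two_smul ℝ, norm_smul]; simp
  rw [h1, h2]
  refine lt_of_pow_lt_pow_left₀ 2 (norm_nonneg _) ?_
  have := mul_self_le_mul_self (norm_nonneg _) h
  rw [h6]
  nlinarith [mul_pos h5 h5]

/-- The strong maximum principle for `a^{ij} ∂_i ∂_j u + b^k ∂_k u = 0`. -/
theorem strong_maximum_principle (hO : IsOpen O) (hR : O ⊆ range (𝓡∂ n))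
    {a : EuclideanSpace ℝ (Fin n) → Matrix (Fin n) (Fin n) ℝ}
    {b : Fin n → EuclideanSpace ℝ (Fin n) → ℝ} {u : EuclideanSpace ℝ (Fin n) → ℝ} {m : ℝ}
    (ha : ∀ x ∈ O, (a x).PosDef) (hac : ∀ i j, ContinuousOn (fun x => a x i j) O)
    (hbc : ∀ k, ContinuousOn (b k) O) (hu : ContDiffOn ℝ ∞ u O)
    (hL : ∀ x ∈ O, ∑ i, ∑ j, a x i j * pd i (pd j u) x + ∑ k, b k x * pd k u x = 0)
    (hle : ∀ x ∈ O, u x ≤ m) {y : EuclideanSpace ℝ (Fin n)} (hy : y ∈ O) (huy : u y = m) :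
    ∀ᶠ x in 𝓝 y, u x = m := by
  obtain ⟨R, hR0, hball⟩ := Metric.isOpen_iff.mp hO y hy
  have hr0 : 0 < R / 4 := by positivity
  filter_upwards [Metric.ball_mem_nhds y hr0] with z₀ hz₀
  rw [Metric.mem_ball] at hz₀
  by_contra hne
  -- Room for the estimates: `z₀` is within $R/4$ of `y`, and points no farther from `z₀` than `y`
  -- is are within $R/2$ of `y`. So the nearest contact point in this closed ball beats every
  -- competitor met below.
  have hcb : Metric.closedBall y (3 * (R / 4)) ⊆ O :=
    (Metric.closedBall_subset_ball (by linarith)).trans hball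
  have hK : IsCompact (Metric.closedBall y (3 * (R / 4)) ∩ u ⁻¹' {m}) :=
    (isCompact_closedBall _ _).of_isClosed_subset
      ((hu.continuousOn.mono hcb).preimage_isClosed_of_isClosed Metric.isClosed_closedBall
        isClosed_singleton) inter_subset_left
  obtain ⟨q, hqK, hqmin⟩ := hK.exists_isMinOn (f := fun x => dist x z₀)
    ⟨y, Metric.mem_closedBall_self (by positivity), huy⟩ (by fun_prop)
  have hqy : dist q z₀ ≤ dist y z₀ :=
    hqmin ⟨Metric.mem_closedBall_self (by positivity), huy⟩
  rw [dist_comm y] at hqy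
  have hqz : q ≠ z₀ := fun h => hne (h ▸ hqK.2)
  have hmid : q ≠ midpoint ℝ z₀ q := fun h => hqz ((midpoint_eq_right_iff ℝ).mp h.symm).symm
  refine no_touching_point hO hR ha hac hbc hu hL hle (hcb hqK.1) hqK.2 hmid
    fun x hx hxq hxm => ?_
  refine lt_of_le_of_ne (hle x hx) fun hxu => ?_
  have h1 := norm_sub_lt_of_norm_sub_midpoint_le hxq hxm
  rw [← dist_eq_norm, ← dist_eq_norm] at h1
  have h2 : x ∈ Metric.closedBall y (3 * (R / 4)) := by
    rw [Metric.mem_closedBall]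
    have := dist_triangle x z₀ y
    linarith
  exact absurd (hqmin ⟨h2, hxu⟩) (not_le.mpr h1)

end MaximumPrinciple

/-! ### Global arguments on a manifold with boundary -/

section GlobalArguments

open Filter Topology Asymptotics

/-- The first-order coefficients of the drift Laplacian. -/
def driftCoefficient {n : ℕ} [NeZero n] (G : EuclideanSpace ℝ (Fin n) → Matrix (Fin n) (Fin n) ℝ)
    (f : EuclideanSpace ℝ (Fin n) → ℝ) (k : Fin n) (y : EuclideanSpace ℝ (Fin n)) : ℝ :=
  -(∑ i, ∑ j, (G y)⁻¹ i j * christoffel G k i j y) - ∑ j, pd j f y * (G y)⁻¹ j k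

theorem IsSmoothMetric.driftLaplacian_eq_sum {n : ℕ} [NeZero n]
    {S : Set (EuclideanSpace ℝ (Fin n))}
    {G : EuclideanSpace ℝ (Fin n) → Matrix (Fin n) (Fin n) ℝ} (hG : IsSmoothMetric S G)
    {f u : EuclideanSpace ℝ (Fin n) → ℝ} (hf : ContDiffOn ℝ ∞ f S) (hu : ContDiffOn ℝ ∞ u S)
    {y : EuclideanSpace ℝ (Fin n)} (hy : y ∈ S) :
    driftLaplacian G f u y = ∑ i, ∑ j, (G y)⁻¹ i j * pd i (pd j u) y +
      ∑ k, driftCoefficient G f k y * pd k u y := by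
  rw [hG.driftLaplacian_eq hf hu hy]
  simp only [laplacian, hessian, driftCoefficient, grad, mul_sub, sub_mul, neg_mul,
    Finset.sum_sub_distrib, Finset.sum_neg_distrib, Finset.mul_sum, Finset.sum_mul]
  have e1 : ∑ i, ∑ j, ∑ k, (G y)⁻¹ i j * (christoffel G k i j y * pd k u y) =
      ∑ k, ∑ i, ∑ j, (G y)⁻¹ i j * christoffel G k i j y * pd k u y := by
    rw [Finset.sum_comm]
    refine (Finset.sum_congr rfl fun j _ => Finset.sum_comm).trans ?_
    rw [Finset.sum_comm]
    refine Finset.sum_congr rfl fun k _ => ?_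
    rw [Finset.sum_comm]
    exact Finset.sum_congr rfl fun _ _ => Finset.sum_congr rfl fun _ _ => by ring
  have e2 : ∑ k, ∑ j, pd k f y * ((G y)⁻¹ k j * pd j u y) =
      ∑ k, ∑ j, pd j f y * (G y)⁻¹ j k * pd k u y := by
    rw [Finset.sum_comm]
    exact Finset.sum_congr rfl fun _ _ => Finset.sum_congr rfl fun _ _ => by ring
  rw [e1, e2]
  ring

theorem IsSmoothMetric.contDiffOn_driftCoefficient {n : ℕ} [NeZero n]
    {S : Set (EuclideanSpace ℝ (Fin n))}
    {G : EuclideanSpace ℝ (Fin n) → Matrix (Fin n) (Fin n) ℝ} (hG : IsSmoothMetric S G)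
    {f : EuclideanSpace ℝ (Fin n) → ℝ} (hf : ContDiffOn ℝ ∞ f S) (k : Fin n) :
    ContDiffOn ℝ ∞ (driftCoefficient G f k) S :=
  ((Represents.sum fun i => Represents.sum fun j =>
    (hG.represents_inv i j).mul (hG.represents_christoffel k i j)).neg.sub
    (Represents.sum fun j => ((represents_toSmooth f hf).pd hG.isRelOpen j).mul
      (hG.represents_inv j k))).contDiffOn

variable {n : ℕ} [NeZero n] {M : Type*} [TopologicalSpace M]
  [ChartedSpace (EuclideanHalfSpace n) M] [IsManifold (𝓡∂ n) ∞ M]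

theorem coordFun_apply_extChartAt (F : M → ℝ) {p q : M} (hq : q ∈ (extChartAt (𝓡∂ n) p).source) :
    coordFun (chartAt (EuclideanHalfSpace n) p) F (extChartAt (𝓡∂ n) p q) = F q :=
  congrArg F ((extChartAt (𝓡∂ n) p).left_inv hq)

theorem eventually_coordFun_iff (F : M → ℝ) {p q : M}
    (hq : q ∈ (extChartAt (𝓡∂ n) p).source) (P : ℝ → Prop) :
    (∀ᶠ z in 𝓝[range (𝓡∂ n)] (extChartAt (𝓡∂ n) p q),
      P (coordFun (chartAt (EuclideanHalfSpace n) p) F z)) ↔ ∀ᶠ q' in 𝓝 q, P (F q') := by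
  rw [← map_extChartAt_nhds' hq, eventually_map]
  refine eventually_congr ?_
  filter_upwards [(isOpen_extChartAt_source p).mem_nhds hq] with q' hq'
  rw [coordFun_apply_extChartAt F hq']

theorem eventually_coordFun_eq_iff (F : M → ℝ) {p q : M}
    (hq : q ∈ (extChartAt (𝓡∂ n) p).source) :
    (∀ᶠ z in 𝓝[range (𝓡∂ n)] (extChartAt (𝓡∂ n) p q),
      coordFun (chartAt (EuclideanHalfSpace n) p) F z =
      coordFun (chartAt (EuclideanHalfSpace n) p) F (extChartAt (𝓡∂ n) p q)) ↔
      ∀ᶠ q' in 𝓝 q, F q' = F q := by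
  rw [coordFun_apply_extChartAt F hq]
  exact eventually_coordFun_iff F hq (· = F q)

theorem frequently_extChartAt {p : M} {P : M → Prop} {Q : EuclideanSpace ℝ (Fin n) → Prop}
    (h : ∃ᶠ q in 𝓝 p, P q)
    (hPQ : ∀ q ∈ (extChartAt (𝓡∂ n) p).source, P q → Q (extChartAt (𝓡∂ n) p q)) :
    ∃ᶠ z in 𝓝[range (𝓡∂ n)] (extChartAt (𝓡∂ n) p p), Q z := by
  rw [← map_extChartAt_nhds p, frequently_map]
  refine (h.and_eventually (extChartAt_source_mem_nhds (I := 𝓡∂ n) p)).mono fun q hq => ?_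
  exact hPQ q hq.2 hq.1

/-- Unique continuation from a point on a connected manifold. -/
theorem eq_zero_of_jet_eq_zero [PreconnectedSpace M] {F : M → ℝ}
    (hF : ContMDiff (𝓡∂ n) 𝓘(ℝ, ℝ) ∞ F)
    (hO : ∀ p, ∀ i j, pd i (pd j (coordFun (chartAt (EuclideanHalfSpace n) p) F))
      =O[𝓝[range (𝓡∂ n)] (extChartAt (𝓡∂ n) p p)] fun z =>
        |coordFun (chartAt (EuclideanHalfSpace n) p) F z| +
          ∑ k, |pd k (coordFun (chartAt (EuclideanHalfSpace n) p) F) z|)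
    {p : M} (h0 : F p = 0)
    (h1 : ∀ i, pd i (coordFun (chartAt (EuclideanHalfSpace n) p) F) (extChartAt (𝓡∂ n) p p) = 0)
    (q : M) : F q = 0 := by
  have huc : ∀ q, F q = 0 →
      (∀ i, pd i (coordFun (chartAt (EuclideanHalfSpace n) q) F) (extChartAt (𝓡∂ n) q q) = 0) →
      ∀ᶠ q' in 𝓝 q, F q' = 0 := by
    intro q hq hq'
    refine (eventually_coordFun_iff F (mem_extChartAt_source (I := 𝓡∂ n) q) (· = 0)).mp ?_
    refine (isRelOpen_extChartAt_target q).eventually_eq_zero (contDiffOn_coordFun hF q)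
      (mem_extChartAt_target q) (hO q) ?_ hq'
    rw [coordFun_apply_extChartAt F (mem_extChartAt_source (I := 𝓡∂ n) q), hq]
  set Z : Set M := {q | ∀ᶠ q' in 𝓝 q, F q' = 0} with hZ
  have hopen : IsOpen Z := isOpen_iff_mem_nhds.mpr fun q hq => eventually_eventually_nhds.mpr hq
  -- At a limit point the whole 1-jet vanishes by continuity, and local unique continuation puts the
  -- point back into `Z`.
  have hclosed : IsClosed Z := by
    refine isClosed_of_closure_subset fun q hq => ?_
    have hS := isRelOpen_extChartAt_target (n := n) q
    have hFq := contDiffOn_coordFun hF q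
    have hfr : ∃ᶠ z in 𝓝[range (𝓡∂ n)] (extChartAt (𝓡∂ n) q q),
        coordFun (chartAt (EuclideanHalfSpace n) q) F z = 0 ∧
        ∀ i, pd i (coordFun (chartAt (EuclideanHalfSpace n) q) F) z = 0 := by
      refine frequently_extChartAt (mem_closure_iff_frequently.mp hq) fun q' hq' hq'Z => ?_
      have hev := (eventually_coordFun_iff F hq' (· = 0)).mpr hq'Z
      have hmem : extChartAt (𝓡∂ n) q q' ∈ range (𝓡∂ n) :=
        hS.subset ((extChartAt (𝓡∂ n) q).map_source hq')
      refine ⟨hev.self_of_nhdsWithin hmem, fun i => ?_⟩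
      rw [pd_congr_of_eventuallyEq hmem (F' := fun _ => 0) hev, pd_const]
    refine huc q ?_ fun i => hS.eq_zero_of_frequently (hS.contDiffOn_pd hFq i)
      (mem_extChartAt_target q) (hfr.mono fun z hz => hz.2 i)
    rw [← coordFun_apply_extChartAt F (mem_extChartAt_source (I := 𝓡∂ n) q)]
    exact hS.eq_zero_of_frequently hFq (mem_extChartAt_target q) (hfr.mono fun z hz => hz.1)
  have huniv := IsClopen.eq_univ ⟨hclosed, hopen⟩ ⟨p, huc p h0 h1⟩
  exact (huniv.symm ▸ mem_univ q : q ∈ Z).self_of_nhds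

variable (g : ContMDiffRiemannianMetric (𝓡∂ n) ∞ (EuclideanSpace ℝ (Fin n))
  (fun p : M => TangentSpace (𝓡∂ n) p))

/-- A positive maximum is attained only at interior points, where the strong maximum principle makes
the set of maximum points open. Being also closed, it is all of `M` and meets the boundary, where
`u` is zero. -/
theorem nonpos_of_driftLaplacian_eq_zero [CompactSpace M] [PreconnectedSpace M]
    (hboundary : ((𝓡∂ n).boundary M).Nonempty) {f u : M → ℝ}
    (hf : ContMDiff (𝓡∂ n) 𝓘(ℝ, ℝ) ∞ f) (hu : ContMDiff (𝓡∂ n) 𝓘(ℝ, ℝ) ∞ u)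
    (hb : ∀ p ∈ (𝓡∂ n).boundary M, u p = 0)
    (hL : ∀ p : M, ∀ z ∈ (extChartAt (𝓡∂ n) p).target,
      driftLaplacian (coordMetric g (chartAt (EuclideanHalfSpace n) p))
        (coordFun (chartAt (EuclideanHalfSpace n) p) f)
        (coordFun (chartAt (EuclideanHalfSpace n) p) u) z = 0) (p : M) : u p ≤ 0 := by
  obtain ⟨p₀, -, hp₀⟩ := isCompact_univ.exists_isMaxOn ⟨p, mem_univ p⟩ hu.continuous.continuousOn
  have hmax : ∀ q, u q ≤ u p₀ := fun q => hp₀ (mem_univ q)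
  refine (hmax p).trans ?_
  by_contra! hpos
  set K : Set M := {q | u q = u p₀} with hK
  have hclosed : IsClosed K := isClosed_eq hu.continuous continuous_const
  have hopen : IsOpen K := by
    refine isOpen_iff_mem_nhds.mpr fun q hq => ?_
    have hint : extChartAt (𝓡∂ n) q q ∈ interior (range (𝓡∂ n)) := by
      rcases (𝓡∂ n).isInteriorPoint_or_isBoundaryPoint q with h | h
      · exact h
      · exact absurd ((hb q h).symm.trans hq) hpos.ne
    have hG := isSmoothMetric_coordMetric g q
    have hfq := contDiffOn_coordFun hf q
    have huq := contDiffOn_coordFun hu q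
    have hmem : extChartAt (𝓡∂ n) q q ∈ interior (extChartAt (𝓡∂ n) q).target := by
      rw [mem_interior_iff_mem_nhds, ← nhdsWithin_eq_nhds.mpr (mem_interior_iff_mem_nhds.mp hint)]
      exact extChartAt_target_mem_nhdsWithin q
    have hsub : interior (extChartAt (𝓡∂ n) q).target ⊆ (extChartAt (𝓡∂ n) q).target :=
      interior_subset
    refine (eventually_coordFun_iff u (mem_extChartAt_source (I := 𝓡∂ n) q) (· = u p₀)).mp
      (Filter.Eventually.filter_mono nhdsWithin_le_nhds ?_)
    refine strong_maximum_principle isOpen_interior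
      (hsub.trans (extChartAt_target_subset_range q))
      (fun x hx => (hG.posDef x (hsub hx)).inv)
      (fun i j => (hG.represents_inv i j).contDiffOn.continuousOn.mono hsub)
      (fun k => (hG.contDiffOn_driftCoefficient hfq k).continuousOn.mono hsub)
      (huq.mono hsub) (fun x hx => ?_) (fun x _ => hmax _) hmem ?_
    · rw [← hG.driftLaplacian_eq_sum hfq huq (hsub hx), hL q x (hsub hx)]
    · rw [coordFun_apply_extChartAt u (mem_extChartAt_source (I := 𝓡∂ n) q)]
      exact hq
  have huniv := IsClopen.eq_univ ⟨hclosed, hopen⟩ ⟨p₀, rfl⟩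
  obtain ⟨b, hbb⟩ := hboundary
  have : b ∈ K := huniv.symm ▸ mem_univ b
  exact hpos.ne ((hb b hbb).symm.trans this)

theorem IsSmoothMetric.driftLaplacian_neg {S : Set (EuclideanSpace ℝ (Fin n))}
    {G : EuclideanSpace ℝ (Fin n) → Matrix (Fin n) (Fin n) ℝ} (hG : IsSmoothMetric S G)
    {f u : EuclideanSpace ℝ (Fin n) → ℝ} (hf : ContDiffOn ℝ ∞ f S) (hu : ContDiffOn ℝ ∞ u S)
    {y : EuclideanSpace ℝ (Fin n)} (hy : y ∈ S) :
    driftLaplacian G f (fun z => -u z) y = -driftLaplacian G f u y := by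
  have hS := hG.isRelOpen
  have hneg : ∀ (i : Fin n) (F : EuclideanSpace ℝ (Fin n) → ℝ),
      EqOn (pd i fun z => -F z) (fun z => -pd i F z) S := fun i F z hz => by
    rw [pd, fderivWithin_fun_neg ((𝓡∂ n).uniqueDiffOn z (hS.subset hz))]
    rfl
  rw [hG.driftLaplacian_eq_sum hf hu hy, hG.driftLaplacian_eq_sum hf hu.neg hy]
  have h2 : ∀ i j, pd i (pd j fun z => -u z) y = -pd i (pd j u) y := fun i j => by
    rw [hS.pd_congr (hneg j u) i hy, hneg i (pd j u) hy]
  simp only [h2, hneg _ u hy, mul_neg, Finset.sum_neg_distrib]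
  ring

theorem eq_zero_of_driftLaplacian_eq_zero [CompactSpace M] [PreconnectedSpace M]
    (hboundary : ((𝓡∂ n).boundary M).Nonempty) {f u : M → ℝ}
    (hf : ContMDiff (𝓡∂ n) 𝓘(ℝ, ℝ) ∞ f) (hu : ContMDiff (𝓡∂ n) 𝓘(ℝ, ℝ) ∞ u)
    (hb : ∀ p ∈ (𝓡∂ n).boundary M, u p = 0)
    (hL : ∀ p : M, ∀ z ∈ (extChartAt (𝓡∂ n) p).target,
      driftLaplacian (coordMetric g (chartAt (EuclideanHalfSpace n) p))
        (coordFun (chartAt (EuclideanHalfSpace n) p) f)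
        (coordFun (chartAt (EuclideanHalfSpace n) p) u) z = 0) (p : M) : u p = 0 := by
  refine le_antisymm (nonpos_of_driftLaplacian_eq_zero g hboundary hf hu hb hL p) ?_
  have hneg : ContMDiff (𝓡∂ n) 𝓘(ℝ, ℝ) ∞ fun p => -u p :=
    (contDiff_neg (𝕜 := ℝ) (F := ℝ) (n := ∞)).contMDiff.comp hu
  have := nonpos_of_driftLaplacian_eq_zero g hboundary hf hneg
    (fun p hp => by rw [hb p hp, neg_zero]) (fun q z hz => by
      have h1 := (isSmoothMetric_coordMetric g q).driftLaplacian_neg (contDiffOn_coordFun hf q)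
        (contDiffOn_coordFun hu q) hz
      rw [hL q z hz, neg_zero] at h1
      exact h1) p
  linarith

theorem perelmanScalar_eq_of_mem_target {f : M → ℝ} {c : ℝ}
    (hR : HasConstantPerelmanScalar g f c) (p : M) :
    ∀ z ∈ (extChartAt (𝓡∂ n) p).target,
      perelmanScalar (coordMetric g (chartAt (EuclideanHalfSpace n) p))
        (coordFun (chartAt (EuclideanHalfSpace n) p) f) z = c := by
  intro z hz
  have h := hR _ (IsManifold.chart_mem_maximalAtlas p) ((extChartAt (𝓡∂ n) p).symm z)
    (by simpa using (extChartAt (𝓡∂ n) p).map_target hz)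
  have hz' : (chartAt (EuclideanHalfSpace n) p).extend (𝓡∂ n) ((extChartAt (𝓡∂ n) p).symm z) = z :=
    (extChartAt (𝓡∂ n) p).right_inv hz
  rwa [hz'] at h

theorem perelmanAdjoint_eq_zero_of_mem_target {f u : M → ℝ} (hu : u ∈ perelmanKernel g f)
    (p : M) : ∀ z ∈ (extChartAt (𝓡∂ n) p).target, ∀ i j,
      perelmanAdjoint (coordMetric g (chartAt (EuclideanHalfSpace n) p))
        (coordFun (chartAt (EuclideanHalfSpace n) p) f)
        (coordFun (chartAt (EuclideanHalfSpace n) p) u) i j z = 0 := by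
  intro z hz i j
  have h := hu.2.2 _ (IsManifold.chart_mem_maximalAtlas p) ((extChartAt (𝓡∂ n) p).symm z)
    (by simpa using (extChartAt (𝓡∂ n) p).map_target hz) i j
  have hz' : (chartAt (EuclideanHalfSpace n) p).extend (𝓡∂ n) ((extChartAt (𝓡∂ n) p).symm z) = z :=
    (extChartAt (𝓡∂ n) p).right_inv hz
  rwa [hz'] at h

/-- In dimension one, `f` is nowhere locally constant. -/
theorem not_locally_const_of_dim_one [PreconnectedSpace M] (hn : n = 1) {f : M → ℝ}
    (hf : ContMDiff (𝓡∂ n) 𝓘(ℝ, ℝ) ∞ f) (hfc : ¬ ∃ c : ℝ, ∀ p : M, f p = c) {c : ℝ}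
    (hR : HasConstantPerelmanScalar g f c) (p : M) : ¬ ∀ᶠ q in 𝓝 p, f q = f p := by
  intro hp
  have hS := isRelOpen_extChartAt_target (n := n) p
  have hy := hS.subset (mem_extChartAt_target p)
  have hev := (eventually_coordFun_eq_iff f (mem_extChartAt_source (I := 𝓡∂ n) p)).mpr hp
  have hc : c = 0 := by
    rw [← scalarCurvature_eq_of_locally_const hy hev
      (perelmanScalar_eq_of_mem_target g hR p _ (mem_extChartAt_target p))]
    simp [scalarCurvature, IsSmoothMetric.ricci_eq_zero_of_dim_one hn]
  subst hc
  refine hfc ⟨f p, fun q => sub_eq_zero.mp ?_⟩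
  -- Subtracting the value `f p` makes the full 1-jet vanish at `p`, as unique continuation
  -- requires.
  refine eq_zero_of_jet_eq_zero (F := fun q => f q - f p) (hf.sub contMDiff_const) (fun q i j =>
    (isSmoothMetric_coordMetric g q).pd_pd_isBigO_of_dim_one hn (contDiffOn_coordFun hf q)
    (perelmanScalar_eq_of_mem_target g hR q) (f p) (mem_extChartAt_target q) i j)
    (p := p) (sub_self _) (fun i => ?_) q
  exact pd_eq_zero_of_locally_const hy (hev.mono fun z hz => congrArg (· - f p) hz) i

/-- The kernel of the adjoint operator is trivial when the Perelman scalar curvature is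
constant. -/
theorem eq_zero_of_mem_perelmanKernel [CompactSpace M] [PreconnectedSpace M]
    (hboundary : ((𝓡∂ n).boundary M).Nonempty) {f : M → ℝ}
    (hf : ContMDiff (𝓡∂ n) 𝓘(ℝ, ℝ) ∞ f) (hfc : ¬ ∃ c : ℝ, ∀ p : M, f p = c) {c : ℝ}
    (hR : HasConstantPerelmanScalar g f c) {u : M → ℝ} (huK : u ∈ perelmanKernel g f) (p : M) :
    u p = 0 := by
  have hu := huK.1
  have hRq := perelmanScalar_eq_of_mem_target g hR
  have hEq := perelmanAdjoint_eq_zero_of_mem_target g huK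
  have hfq := fun q => contDiffOn_coordFun hf q
  have huq := fun q => contDiffOn_coordFun hu q
  set U : Set M := {q | ∀ᶠ q' in 𝓝 q, f q' = f q} with hU
  have hopen : IsOpen U := by
    refine isOpen_iff_mem_nhds.mpr fun q hq => ?_
    filter_upwards [hq, eventually_eventually_nhds.mpr hq] with q' h1 h2
    filter_upwards [h2] with q'' h3
    rw [h3, h1]
  have hUne : U ≠ univ := fun h => hfc (by
    have hlc : IsLocallyConstant f := (IsLocallyConstant.iff_eventually_eq f).mpr fun q =>
      (h.symm ▸ mem_univ q : q ∈ U)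
    exact ⟨f p, fun q => hlc.apply_eq_of_preconnectedSpace q p⟩)
  -- Reduction to the points where `f` is locally constant: elsewhere $\Delta_fu=0$ is already
  -- known, and the maximum principle finishes.
  have hlocal : (∀ q : M, ∀ z ∈ (extChartAt (𝓡∂ n) q).target,
      (∀ᶠ w in 𝓝[range (𝓡∂ n)] z, coordFun (chartAt (EuclideanHalfSpace n) q) f w =
        coordFun (chartAt (EuclideanHalfSpace n) q) f z) →
      driftLaplacian (coordMetric g (chartAt (EuclideanHalfSpace n) q))
        (coordFun (chartAt (EuclideanHalfSpace n) q) f)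
        (coordFun (chartAt (EuclideanHalfSpace n) q) u) z = 0) → u p = 0 := by
    intro h
    refine eq_zero_of_driftLaplacian_eq_zero g hboundary hf hu huK.2.1 (fun q z hz => ?_) p
    by_cases hc : ∀ᶠ w in 𝓝[range (𝓡∂ n)] z, coordFun (chartAt (EuclideanHalfSpace n) q) f w =
        coordFun (chartAt (EuclideanHalfSpace n) q) f z
    · exact h q z hz hc
    · exact ((isSmoothMetric_coordMetric g q).driftLaplacian_eq_zero_of_not_locally_const (hfq q)
        (huq q) (hRq q) (hEq q) hz hc).1
  have hempty : U = ∅ → u p = 0 := fun he => hlocal fun q z hz hc => by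
    have hsrc := (extChartAt (𝓡∂ n) q).map_target hz
    have hrinv := (extChartAt (𝓡∂ n) q).right_inv hz
    have : (extChartAt (𝓡∂ n) q).symm z ∈ U :=
      (eventually_coordFun_eq_iff f hsrc).mp (by rwa [hrinv])
    rw [he] at this
    exact this.elim
  by_cases hn : n = 1
  · exact hempty (eq_empty_of_forall_notMem fun q hq =>
      not_locally_const_of_dim_one g hn hf hfc hR q hq)
  by_cases hc : c = 0
  · refine hlocal fun q z hz hcz => ?_
    have h := (isSmoothMetric_coordMetric g q).sub_one_mul_driftLaplacian_of_locally_const (hfq q)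
      (huq q) (hRq q) (hEq q) hz hcz
    rw [hc, zero_mul, add_zero] at h
    exact (mul_eq_zero.mp h).resolve_left (sub_ne_zero.mpr (by exact_mod_cast hn))
  rcases U.eq_empty_or_nonempty with he | hne
  · exact hempty he
  -- If the nonempty open proper subset `U` were closed, connectedness would fail. At such a `q`
  -- both vanishing results for jets apply.
  obtain ⟨q, hqc, hqU⟩ : ∃ q ∈ closure U, q ∉ U := by
    by_contra! h
    exact hUne (IsClopen.eq_univ ⟨isClosed_of_closure_subset h, hopen⟩ hne)
  have hjet := (isSmoothMetric_coordMetric g q).jet_eq_zero_of_frequently_locally_const (hfq q)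
    (huq q) (hRq q) hc (hEq q) (mem_extChartAt_target q)
    (fun h => hqU ((eventually_coordFun_eq_iff f (mem_extChartAt_source (I := 𝓡∂ n) q)).mp h))
    (frequently_extChartAt (mem_closure_iff_frequently.mp hqc) fun q' hq' hq'U =>
      (eventually_coordFun_eq_iff f hq').mpr hq'U)
  rw [coordFun_apply_extChartAt u (mem_extChartAt_source (I := 𝓡∂ n) q)] at hjet
  exact eq_zero_of_jet_eq_zero hu (fun q' i j =>
    (isSmoothMetric_coordMetric g q').pd_pd_isBigO_of_kernel hn (hfq q') (huq q') (hEq q')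
    (mem_extChartAt_target q') i j) hjet.1 hjet.2 p

end GlobalArguments

end PSingular

end

theorem mainTheorem9 {n : ℕ} [NeZero n] {M : Type*} [TopologicalSpace M] [T2Space M]
    [CompactSpace M] [ConnectedSpace M] [ChartedSpace (EuclideanHalfSpace n) M]
    [IsManifold (𝓡∂ n) ∞ M]
    (hboundary : ((𝓡∂ n).boundary M).Nonempty)
    (g : ContMDiffRiemannianMetric (𝓡∂ n) ∞ (EuclideanSpace ℝ (Fin n))
      (fun p : M => TangentSpace (𝓡∂ n) p))
    (f : M → ℝ) (hf : ContMDiff (𝓡∂ n) 𝓘(ℝ, ℝ) ∞ f) (hfc : ¬ ∃ c : ℝ, ∀ p : M, f p = c)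
    (hR : ∃ c : ℝ, PSingular.HasConstantPerelmanScalar g f c) :
    ¬ PSingular.IsPSingular g f := by
  obtain ⟨c, hR⟩ := hR
  rintro ⟨u, huK, hu0⟩
  exact hu0 (funext (PSingular.eq_zero_of_mem_perelmanKernel g hboundary hf hfc hR huK))
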